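/- **Setting.** Let $(M,g)$ be a smooth Lorentzian manifold of dimension $m\ge 4$ (signature $(-,+,\dots,+)$) with Levi-Civita connection $\nabla$. Let $M$ be foliated by the timelike level sets $S_s=\{\Phi=s\}$ of a smooth function $\Phi$, with lapse $\varphi=\|\nabla\Phi\|^{-1}>0$ and unit normal $n_\alpha=\pm\varphi\nabla_\alpha\Phi$, $n^\alpha n_\alpha=1$. Write $h_{\alpha\beta}=g_{\alpha\beta}-n_\alpha n_\beta$, let $\chi_{\alpha\beta}=h^\lambda_\alpha h^\rho_\beta\nabla_\lambda n_\rho$ be the second fundamental form, and let $\mathcal D$ denote differentiation along the slices. Let $\mathcal K_1,\mathcal K_2$ be smooth conformal Killing fields tangent to all slices, with Gram matrix $\mathcal G_{ab}=\mathcal K_{a\alpha}\mathcal K_b{}^\alpha$, inverse $\mathcal G^{ab}$ and $\mathcal G=\det\mathcal G_{ab}\le 0$. Call a point regular if $\mathcal G<0$ there; the regular points are assumed dense in every slice (all points may be regular; an axis of rotation is allowed). Suppose that at all regular points the following hold, with a function $\chi$ which is smooth there. 1. For all vectors $X,Y$ tangent to the slice and orthogonal to $\mathcal K_1,\mathcal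 K_2$: $\chi_{\alpha\beta}\mathcal K_a{}^\alpha X^\beta=0$ and $\chi_{\alpha\beta}X^\alpha Y^\beta=\chi\,h_{\alpha\beta}X^\alpha Y^\beta$ (partial umbilicity; this determines $\chi$). 2. $\mathcal D_\gamma(\varphi\chi-\varphi\,n^\alpha\nabla_\alpha\ln\varphi)=0$. 3. Where $\chi\ne0$: $$\mathcal D_\gamma\Big(\mathcal G^{ab}+\tfrac1{2\chi}n^\alpha\nabla_\alpha\mathcal G^{ab}\Big)=-\mathcal D_\gamma\ln(\chi\varphi^3)\Big(\mathcal G^{ab}+\tfrac1{2\chi}n^\alpha\nabla_\alpha\mathcal G^{ab}\Big);$$ at points near which $\chi$ vanishes identically along the slice, instead $\mathcal D_\gamma(n^\alpha\nabla_\alpha\mathcal G^{ab})=-\mathcal D_\gamma\ln\varphi^3\cdot n^\alpha\nabla_\alpha\mathcal G^{ab}$. (Here $\ln$ means $\ln|\cdot|$.) Where $\chi\neq 0$, put $$\mathcal M_{ab}=\tfrac1{2\chi}n^\alpha\nabla_\alpha\mathcal G_{ab}-\tfrac1{2\chi}\big(n^\alpha\nabla_\alpha\ln\mathcal G\big)\mathcal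 G_{ab}+\mathcal G_{ab},$$ and call $\rho^a\mathcal M_{ab}\rho^b=0$ the master equation. For $\rho^a$ put $\rho^\alpha=\rho^a\mathcal K_a{}^\alpha$, $\tau^a=\sqrt{-\mathcal G}\,\mathcal G^{ab}\epsilon_{bc}\rho^c$ and $\tau_a=\mathcal G_{ab}\tau^b$, where $\epsilon_{12}=-\epsilon_{21}=1$, $\epsilon_{11}=\epsilon_{22}=0$. **Definitions.** A subset $U$ of a slice has *compact spatial sections* if there is a smooth function $T$, defined near $U$, whose level sets within the slice are spacelike at the points of $U$ and such that $U\cap\{T=c\}$ is compact for every $c\in\mathbb R$. A subset $U\subseteq S_s$ is a *fundamental photon surface* with impact vector $\rho^a$ if it has compact spatial sections and, at all its regular points, the slice is partially umbilic in the sense of 1, $\chi\neq0$, $\rho^a$ is differentiable and non-zero, $\rho_\alpha\rho^\alpha\ge0$, the direction of $\rho^a$ is constant along the slice, i.e. $\tau_a\mathcal D_\alpha\rho^a=0$, and the master equation holds. For a set $D\subseteq S_s$ of regular points on which $\rho^a$ is given, the *maximal non-timelike subdomain* of $D$ is $\{p\in D:\rho_\alpha\rho^\alpha\ge0\}$ together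 with those non-regular points of $S_s$ that are limits of it. **Theorem.** Let $S_s$ be a slice with compact spatial sections and with $\chi\ne0$ at all its regular points. (i) Let $D$ be the set of regular points of $S_s$ at which the master equation has a real solution $\rho^a\neq0$, and let $\rho^a$ be a differentiable, nowhere vanishing solution of the master equation on $D$; at points of $D$ where the slice is totally umbilic ($\chi_{\alpha\beta}\propto h_{\alpha\beta}$), where $\mathcal M_{ab}=0$ and the master equation is vacuous, assume in addition that $\tau_a\mathcal D_\alpha\rho^a=0$. Then the maximal non-timelike subdomain of $D$ is a fundamental photon surface with impact vector $\rho^a$; in particular, the direction of $\rho^a$ is constant along the slice on it. (ii) If $p_0$ is a regular point of $S_s$ and the constant vector $\rho_0^a\ne0$ solves the master equation at $p_0$, then $\rho_0^a$ solves it on the whole connected component $C$ of $p_0$ in the set of regular points of $S_s$, and the maximal non-timelike subdomain of $C$ for $\rho^a\equiv\rho^a_0$ is a fundamental photon surface with impact vector $\rho_0^a$. -/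

import Mathlib

open scoped Manifold ContDiff Topology Matrix

noncomputable section

namespace PhotonSurface

/-- A smooth Lorentzian metric of signature `(-,+,…,+)` on an `m`-dimensional manifold: at every
point there is a timelike vector whose orthogonal complement is positive definite. -/
structure LorentzianMetric (m : ℕ) (M : Type*) [TopologicalSpace M]
    [ChartedSpace (EuclideanSpace ℝ (Fin m)) M] [IsManifold (𝓡 m) ∞ M] where
  /-- The scalar product `g_{αβ} v^α w^β` on each tangent space. -/
  val (p : M) : TangentSpace (𝓡 m) p →L[ℝ] TangentSpace (𝓡 m) p →L[ℝ] ℝ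
  symm (p : M) (v w : TangentSpace (𝓡 m) p) : val p v w = val p w v
  signature (p : M) : ∃ v : TangentSpace (𝓡 m) p, val p v v < 0 ∧
    ∀ w : TangentSpace (𝓡 m) p, w ≠ 0 → val p v w = 0 → 0 < val p w w
  contMDiff : ContMDiff (𝓡 m)
    ((𝓡 m).prod 𝓘(ℝ, EuclideanSpace ℝ (Fin m) →L[ℝ] EuclideanSpace ℝ (Fin m) →L[ℝ] ℝ)) ∞
    (fun p ↦ Bundle.TotalSpace.mk'
      (EuclideanSpace ℝ (Fin m) →L[ℝ] EuclideanSpace ℝ (Fin m) →L[ℝ] ℝ)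
      (E := fun p : M ↦ TangentSpace (𝓡 m) p →L[ℝ] TangentSpace (𝓡 m) p →L[ℝ] ℝ) p (val p))

section Manifold

variable {m : ℕ} {M : Type*} [TopologicalSpace M]
  [ChartedSpace (EuclideanSpace ℝ (Fin m)) M] [IsManifold (𝓡 m) ∞ M]

/-- Differentiability at a point of a vector field. -/
def VectorFieldDiffAt (Y : ∀ p : M, TangentSpace (𝓡 m) p) (p : M) : Prop :=
  MDifferentiableAt (𝓡 m) ((𝓡 m).prod 𝓘(ℝ, EuclideanSpace ℝ (Fin m)))
    (fun q ↦ Bundle.TotalSpace.mk' (EuclideanSpace ℝ (Fin m))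
      (E := fun p : M ↦ TangentSpace (𝓡 m) p) q (Y q)) p

/-- Smoothness of a vector field. -/
def SmoothVectorField (Y : ∀ p : M, TangentSpace (𝓡 m) p) : Prop :=
  ContMDiff (𝓡 m) ((𝓡 m).prod 𝓘(ℝ, EuclideanSpace ℝ (Fin m))) ∞
    (fun q ↦ Bundle.TotalSpace.mk' (EuclideanSpace ℝ (Fin m))
      (E := fun p : M ↦ TangentSpace (𝓡 m) p) q (Y q))

/-- The derivative `X^α ∇_α f` at `p` of a scalar function `f` in the direction `X`. -/
def dirDeriv (f : M → ℝ) (p : M) (X : TangentSpace (𝓡 m) p) : ℝ :=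
  mvfderiv (𝓡 m) f p X

/-- `nabla` is the Levi-Civita connection of `g`: it is torsion free and `g` is parallel.
(`nabla Y p v` is `∇_v Y` at `p`.) -/
def IsLeviCivita (g : LorentzianMetric m M)
    (nabla : CovariantDerivative (𝓡 m) (EuclideanSpace ℝ (Fin m))
      (fun p : M ↦ TangentSpace (𝓡 m) p)) : Prop :=
  nabla.torsion = 0 ∧
  ∀ (p : M) (Y Z : ∀ q : M, TangentSpace (𝓡 m) q), VectorFieldDiffAt Y p → VectorFieldDiffAt Z p →
    ∀ v : TangentSpace (𝓡 m) p,
      dirDeriv (fun q ↦ g.val q (Y q) (Z q)) p v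
        = g.val p (nabla Y p v) (Z p) + g.val p (Y p) (nabla Z p v)

/-- `Y` is a conformal Killing vector field, `∇_α Y_β + ∇_β Y_α = 2 Ω g_{αβ}` with
`Ω = m⁻¹ ∇_α Y^α`. -/
def IsConformalKilling (g : LorentzianMetric m M)
    (nabla : CovariantDerivative (𝓡 m) (EuclideanSpace ℝ (Fin m))
      (fun p : M ↦ TangentSpace (𝓡 m) p))
    (Y : ∀ p : M, TangentSpace (𝓡 m) p) : Prop :=
  ∀ (p : M) (v w : TangentSpace (𝓡 m) p),
    g.val p (nabla Y p v) w + g.val p v (nabla Y p w)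
      = 2 * ((1 / (m : ℝ)) * LinearMap.trace ℝ (TangentSpace (𝓡 m) p) (nabla Y p).toLinearMap)
        * g.val p v w

/-- A foliation by timelike hypersurfaces: the slices are the level sets of a smooth function `Φ`
with spacelike gradient, `φ > 0` is the lapse and `n` is the unit normal, i.e.
`n_α = ± φ ∇_α Φ` and `n^α n_α = 1`. -/
structure TimelikeFoliation (g : LorentzianMetric m M) where
  /-- The foliation function. -/
  Φ : M → ℝ
  /-- The lapse function `‖∇Φ‖⁻¹`. -/
  φ : M → ℝ
  /-- The unit normal of the slices. -/
  n : ∀ p : M, TangentSpace (𝓡 m) p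
  /-- The choice of sign of the normal. -/
  sgn : ℝ
  sgn_eq : sgn = 1 ∨ sgn = -1
  smooth_Φ : ContMDiff (𝓡 m) 𝓘(ℝ, ℝ) ∞ Φ
  smooth_φ : ContMDiff (𝓡 m) 𝓘(ℝ, ℝ) ∞ φ
  smooth_n : SmoothVectorField n
  φ_pos : ∀ p, 0 < φ p
  normal : ∀ (p : M) (X : TangentSpace (𝓡 m) p), g.val p (n p) X = sgn * φ p * dirDeriv Φ p X
  unit : ∀ p, g.val p (n p) (n p) = 1

namespace TimelikeFoliation

variable {g : LorentzianMetric m M} (F : TimelikeFoliation g)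

/-- The slice `S_s = {Φ = s}`. -/
def slice (s : ℝ) : Set M := {p | F.Φ p = s}

/-- `X` is tangent to the slice through `p`. -/
def Tangent (p : M) (X : TangentSpace (𝓡 m) p) : Prop := dirDeriv F.Φ p X = 0

/-- The normal derivative `n^α ∇_α f`. -/
def normalDeriv (f : M → ℝ) (p : M) : ℝ := dirDeriv f p (F.n p)

/-- `D_γ f = 0` at `p`: the derivative of `f` at `p` along all
directions tangent to the slice vanishes. -/
def SliceStationaryAt (f : M → ℝ) (p : M) : Prop :=
  ∀ X : TangentSpace (𝓡 m) p, F.Tangent p X → dirDeriv f p X = 0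

/-- The projector `h^α_β = δ^α_β - n^α n_β`. -/
def proj (p : M) (X : TangentSpace (𝓡 m) p) : TangentSpace (𝓡 m) p :=
  X - g.val p (F.n p) X • F.n p

/-- The second fundamental form `χ_{αβ} = h^λ_α h^ρ_β ∇_λ n_ρ`. -/
def secondForm (nabla : CovariantDerivative (𝓡 m) (EuclideanSpace ℝ (Fin m))
      (fun p : M ↦ TangentSpace (𝓡 m) p)) (p : M) (X Y : TangentSpace (𝓡 m) p) : ℝ :=
  g.val p (nabla F.n p (F.proj p X)) (F.proj p Y)

/-- The slice is totally umbilic at `p`: `χ_{αβ}` is proportional to the induced metric. -/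
def IsUmbilicAt (nabla : CovariantDerivative (𝓡 m) (EuclideanSpace ℝ (Fin m))
      (fun p : M ↦ TangentSpace (𝓡 m) p)) (p : M) : Prop :=
  ∃ c : ℝ, ∀ X Y : TangentSpace (𝓡 m) p, F.Tangent p X → F.Tangent p Y →
    F.secondForm nabla p X Y = c * g.val p X Y

/-- A subset `U` of a slice has compact spatial sections: there is a time function `T` on `U`,
i.e. a smooth function whose level sets within the slice are spacelike, such that every level set
of `T` in `U` is compact. -/
def HasCompactSpatialSections (U : Set M) : Prop :=
  ∃ T : M → ℝ,
    (∀ p ∈ U, ContMDiffAt (𝓡 m) 𝓘(ℝ, ℝ) ∞ T p) ∧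
    (∀ p ∈ U, ∀ X : TangentSpace (𝓡 m) p, F.Tangent p X → dirDeriv T p X = 0 → X ≠ 0 →
      0 < g.val p X X) ∧
    ∀ c : ℝ, IsCompact (U ∩ {p | T p = c})

end TimelikeFoliation

/-- The Gram matrix `𝒢_{ab} = K_{aα} K_b^α`. -/
def gram (g : LorentzianMetric m M) (K : Fin 2 → ∀ p : M, TangentSpace (𝓡 m) p) (p : M) :
    Matrix (Fin 2) (Fin 2) ℝ :=
  Matrix.of fun a b ↦ g.val p (K a p) (K b p)

/-- The points at which the Gram matrix is non-degenerate, with `K_1`, `K_2` spanning a timelike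
plane: `det 𝒢 < 0`. -/
def regularSet (g : LorentzianMetric m M) (K : Fin 2 → ∀ p : M, TangentSpace (𝓡 m) p) : Set M :=
  {p | (gram g K p).det < 0}

/-- Two smooth conformal Killing fields tangent to the slices which span a timelike surface; the
Gram matrix is non-degenerate except on a subset which is nowhere dense in every slice (such as an
axis of rotation, possibly empty). -/
structure IsTangentConformalPair (g : LorentzianMetric m M)
    (nabla : CovariantDerivative (𝓡 m) (EuclideanSpace ℝ (Fin m))
      (fun p : M ↦ TangentSpace (𝓡 m) p))
    (F : TimelikeFoliation g) (K : Fin 2 → ∀ p : M, TangentSpace (𝓡 m) p) : Prop where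
  smooth : ∀ a, SmoothVectorField (K a)
  killing : ∀ a, IsConformalKilling g nabla (K a)
  tangent : ∀ a p, F.Tangent p (K a p)
  det_nonpos : ∀ p, (gram g K p).det ≤ 0
  dense : ∀ s, F.slice s ⊆ closure (F.slice s ∩ regularSet g K)

/-- `X` belongs to the orthogonal complement of `K_1`, `K_2` in the tangent space of the slice. -/
def IsComplementary {g : LorentzianMetric m M} (F : TimelikeFoliation g)
    (K : Fin 2 → ∀ p : M, TangentSpace (𝓡 m) p) (p : M) (X : TangentSpace (𝓡 m) p) : Prop :=
  F.Tangent p X ∧ ∀ a, g.val p (K a p) X = 0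

/-- The slice is partially umbilic at `p` with curvature `χ p`: the second fundamental form is
block diagonal with respect to `span {K_a}` and its orthogonal complement, and equals `χ` times
the metric on the latter. As the complement has positive dimension for `m ≥ 4`, this determines
`χ` as the normalized trace of the second fundamental form over the complement. -/
def IsPartiallyUmbilicAt {g : LorentzianMetric m M}
    (nabla : CovariantDerivative (𝓡 m) (EuclideanSpace ℝ (Fin m))
      (fun p : M ↦ TangentSpace (𝓡 m) p))
    (F : TimelikeFoliation g) (K : Fin 2 → ∀ p : M, TangentSpace (𝓡 m) p) (χ : M → ℝ) (p : M) :
    Prop :=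
  (∀ (a : Fin 2) (X : TangentSpace (𝓡 m) p), IsComplementary F K p X →
    F.secondForm nabla p (K a p) X = 0) ∧
  ∀ X Y : TangentSpace (𝓡 m) p, IsComplementary F K p X → IsComplementary F K p Y →
    F.secondForm nabla p X Y = χ p * g.val p X Y

/-- The function `𝒢^{ab}`, an entry of the inverse Gram matrix. -/
def gramInv (g : LorentzianMetric m M) (K : Fin 2 → ∀ p : M, TangentSpace (𝓡 m) p)
    (a b : Fin 2) (p : M) : ℝ :=
  (gram g K p)⁻¹ a b

/-- The conditions on a foliation with tangent conformal Killing fields under which it generates a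
slice-reducible conformal Killing tensor, imposed where the Gram matrix is non-degenerate. -/
structure SatisfiesLiftConditions {g : LorentzianMetric m M}
    (nabla : CovariantDerivative (𝓡 m) (EuclideanSpace ℝ (Fin m))
      (fun p : M ↦ TangentSpace (𝓡 m) p))
    (F : TimelikeFoliation g) (K : Fin 2 → ∀ p : M, TangentSpace (𝓡 m) p) (χ : M → ℝ) :
    Prop where
  smooth_χ : ContMDiffOn (𝓡 m) 𝓘(ℝ, ℝ) ∞ χ (regularSet g K)
  umbilic : ∀ p ∈ regularSet g K, IsPartiallyUmbilicAt nabla F K χ p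
  /-- `D_γ (φ χ - φ n^α ∇_α ln φ) = 0`. -/
  integrable_lapse : ∀ p ∈ regularSet g K,
    F.SliceStationaryAt
      (fun q ↦ F.φ q * χ q - F.φ q * F.normalDeriv (fun r ↦ Real.log (F.φ r)) q) p
  /-- `D_γ (𝒢^{ab} + (2χ)⁻¹ n^α ∇_α 𝒢^{ab})
    = - D_γ ln (χ φ³) (𝒢^{ab} + (2χ)⁻¹ n^α ∇_α 𝒢^{ab})` where `χ ≠ 0`. -/
  integrable_gram : ∀ p ∈ regularSet g K, χ p ≠ 0 → ∀ a b : Fin 2,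
    ∀ X : TangentSpace (𝓡 m) p, F.Tangent p X →
      dirDeriv (fun q ↦ gramInv g K a b q
          + 1 / (2 * χ q) * F.normalDeriv (gramInv g K a b) q) p X
        = - dirDeriv (fun q ↦ Real.log (χ q * F.φ q ^ 3)) p X
          * (gramInv g K a b p + 1 / (2 * χ p) * F.normalDeriv (gramInv g K a b) p)
  /-- `D_γ (n^α ∇_α 𝒢^{ab}) = - D_γ ln φ³ · n^α ∇_α 𝒢^{ab}` where `χ` vanishes identically along
  the slice. -/
  integrable_gram_zero : ∀ p ∈ regularSet g K,
    (∀ᶠ q in 𝓝[F.slice (F.Φ p)] p, χ q = 0) → ∀ a b : Fin 2,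
    ∀ X : TangentSpace (𝓡 m) p, F.Tangent p X →
      dirDeriv (F.normalDeriv (gramInv g K a b)) p X
        = - dirDeriv (fun q ↦ Real.log (F.φ q ^ 3)) p X * F.normalDeriv (gramInv g K a b) p

/-- The matrix
`ℳ_{ab} = (2χ)⁻¹ n^α ∇_α 𝒢_{ab} - (2χ)⁻¹ (n^α ∇_α ln 𝒢) 𝒢_{ab} + 𝒢_{ab}`, `𝒢 = det 𝒢_{ab}`
(`Real.log` is `log |·|`). -/
def masterMatrix {g : LorentzianMetric m M} (F : TimelikeFoliation g)
    (K : Fin 2 → ∀ p : M, TangentSpace (𝓡 m) p) (χ : M → ℝ) (p : M) :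
    Matrix (Fin 2) (Fin 2) ℝ :=
  Matrix.of fun a b ↦
    1 / (2 * χ p) * F.normalDeriv (fun q ↦ gram g K q a b) p
      - 1 / (2 * χ p) * F.normalDeriv (fun q ↦ Real.log (gram g K q).det) p * gram g K p a b
      + gram g K p a b

/-- The master equation `ρ^a ℳ_{ab} ρ^b = 0` at `p`. -/
def MasterEq {g : LorentzianMetric m M} (F : TimelikeFoliation g)
    (K : Fin 2 → ∀ p : M, TangentSpace (𝓡 m) p) (χ : M → ℝ) (p : M) (v : Fin 2 → ℝ) : Prop :=
  ∑ a, ∑ b, v a * masterMatrix F K χ p a b * v b = 0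

/-- The norm `ρ_α ρ^α` of the vector `ρ^α = ρ^a K_a^α`. -/
def impactNormSq (g : LorentzianMetric m M) (K : Fin 2 → ∀ p : M, TangentSpace (𝓡 m) p)
    (p : M) (v : Fin 2 → ℝ) : ℝ :=
  g.val p (∑ a, v a • K a p) (∑ a, v a • K a p)

/-- The covector `τ_a = 𝒢_{ab} τ^b`, where `τ^a = √(-𝒢) 𝒢^{ab} ε_{bc} ρ^c` is orthogonal
to `ρ^a` and `ε_{12} = - ε_{21} = 1`. -/
def tauLower (g : LorentzianMetric m M) (K : Fin 2 → ∀ p : M, TangentSpace (𝓡 m) p)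
    (p : M) (v : Fin 2 → ℝ) : Fin 2 → ℝ :=
  gram g K p *ᵥ (√(-(gram g K p).det) • ((gram g K p)⁻¹ *ᵥ (!![0, 1; -1, 0] *ᵥ v)))

/-- `τ_a D_α ρ^a = 0` at `p`: the direction of `ρ^a` is constant along the slice. -/
def DirectionConstAt {g : LorentzianMetric m M} (F : TimelikeFoliation g)
    (K : Fin 2 → ∀ p : M, TangentSpace (𝓡 m) p) (ρ : M → Fin 2 → ℝ) (p : M) : Prop :=
  ∀ X : TangentSpace (𝓡 m) p, F.Tangent p X →
    ∑ a, tauLower g K p (ρ p) a * dirDeriv (fun q ↦ ρ q a) p X = 0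

/-- The points of the slice `S_s` with non-degenerate Gram matrix at which the master equation has
a real solution `ρ^a ≠ 0`. -/
def solvableSet {g : LorentzianMetric m M} (F : TimelikeFoliation g)
    (K : Fin 2 → ∀ p : M, TangentSpace (𝓡 m) p) (χ : M → ℝ) (s : ℝ) : Set M :=
  {p | p ∈ F.slice s ∧ p ∈ regularSet g K ∧ ∃ v : Fin 2 → ℝ, v ≠ 0 ∧ MasterEq F K χ p v}

/-- `ρ^a` is a differentiable, nowhere vanishing solution of the master equation on the part of
the slice `S_s` where the latter is solvable. At totally umbilic points the master equation is
vacuous and does not determine `ρ^a`; there `ρ^a` is taken of constant direction. -/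
structure IsImpactField {g : LorentzianMetric m M}
    (nabla : CovariantDerivative (𝓡 m) (EuclideanSpace ℝ (Fin m))
      (fun p : M ↦ TangentSpace (𝓡 m) p))
    (F : TimelikeFoliation g) (K : Fin 2 → ∀ p : M, TangentSpace (𝓡 m) p) (χ : M → ℝ) (s : ℝ)
    (ρ : M → Fin 2 → ℝ) : Prop where
  diff : ∀ p ∈ solvableSet F K χ s, MDifferentiableAt (𝓡 m) 𝓘(ℝ, Fin 2 → ℝ) ρ p
  ne_zero : ∀ p ∈ solvableSet F K χ s, ρ p ≠ 0
  master : ∀ p ∈ solvableSet F K χ s, MasterEq F K χ p (ρ p)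
  at_umbilic : ∀ p ∈ solvableSet F K χ s, F.IsUmbilicAt nabla p → DirectionConstAt F K ρ p

/-- The maximal part of `D ⊆ S_s` (a set of points with non-degenerate Gram matrix) on which
`ρ_α ρ^α ≥ 0`, completed by those points of `S_s` with degenerate Gram matrix that are limits of
it. -/
def photonDomain {g : LorentzianMetric m M} (F : TimelikeFoliation g)
    (K : Fin 2 → ∀ p : M, TangentSpace (𝓡 m) p) (s : ℝ) (D : Set M) (ρ : M → Fin 2 → ℝ) :
    Set M :=
  {p | p ∈ D ∧ 0 ≤ impactNormSq g K p (ρ p)} ∪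
  {p | p ∈ F.slice s ∧ p ∉ regularSet g K ∧
    p ∈ closure {q | q ∈ D ∧ 0 ≤ impactNormSq g K q (ρ q)}}

/-- `U ⊆ S_s` is a fundamental photon surface with impact vector `ρ^a`: it has compact spatial
sections and, wherever `K_1`, `K_2` are not degenerate, it is partially umbilic and `ρ^a ≠ 0` is
non-timelike, has constant direction along the slice and solves the master equation. -/
structure IsFundamentalPhotonSurface {g : LorentzianMetric m M}
    (nabla : CovariantDerivative (𝓡 m) (EuclideanSpace ℝ (Fin m))
      (fun p : M ↦ TangentSpace (𝓡 m) p))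
    (F : TimelikeFoliation g) (K : Fin 2 → ∀ p : M, TangentSpace (𝓡 m) p) (χ : M → ℝ) (s : ℝ)
    (U : Set M) (ρ : M → Fin 2 → ℝ) : Prop where
  subset : U ⊆ F.slice s
  compact : F.HasCompactSpatialSections U
  umbilic : ∀ p ∈ U ∩ regularSet g K, IsPartiallyUmbilicAt nabla F K χ p
  χ_ne_zero : ∀ p ∈ U ∩ regularSet g K, χ p ≠ 0
  diff : ∀ p ∈ U ∩ regularSet g K, MDifferentiableAt (𝓡 m) 𝓘(ℝ, Fin 2 → ℝ) ρ p
  ne_zero : ∀ p ∈ U ∩ regularSet g K, ρ p ≠ 0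
  nontimelike : ∀ p ∈ U ∩ regularSet g K, 0 ≤ impactNormSq g K p (ρ p)
  direction : ∀ p ∈ U ∩ regularSet g K, DirectionConstAt F K ρ p
  master : ∀ p ∈ U ∩ regularSet g K, MasterEq F K χ p (ρ p)

end Manifold

end PhotonSurface

end

open PhotonSurface

/-! The theorem rests on a conservation law. Condition 3 is the logarithmic form of the statement
that `liftDensity`, that is $\chi\varphi^3\big(\mathcal
G^{ab}+\tfrac1{2\chi}n^\alpha\nabla_\alpha\mathcal G^{ab}\big)$, has no derivative along the slice.
For $2\times2$ matrices the adjugate is linear and $\operatorname{adj}\mathcal G_{ab}=\mathcal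
G\,\mathcal G^{ab}$, so the bracket is $\mathcal G^{-1}\operatorname{adj}\mathcal M$
(`masterMatrix_adjugate`). Hence along a slice $\mathcal M_{ab}$ is locally constant up to a
non-zero factor (`eventually_masterMatrix_eq_smul`), and the solutions of the master equation are
locally the same at all regular points.

Part (ii) propagates a constant solution over a connected component. In part (i), where $\mathcal
M\ne0$, the field solves one fixed non-zero quadratic equation in two unknowns, which forces a
constant direction (`directionConstAt_of_masterEq`). Where $\mathcal M=0$, the slice is totally
umbilic (`isUmbilicAt_of_masterMatrix_eq_zero`), and constancy of direction is a hypothesis there.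

Local constancy also makes the two sets $D$ and $C$ closed relative to the regular points of the
slice. The non-timelike condition is closed, so after adding the degenerate limit points the
subdomain is closed in the slice, and its time sections are closed subsets of compact ones. -/

namespace PhotonSurface

/-! ### Straightening level sets in a normed space. -/

/-- Near a point where the differential does not vanish, the level set of a function is the image
of a differentiable map from the ambient space. -/
theorem exists_levelSet_param {E : Type*} [NormedAddCommGroup E] [NormedSpace ℝ E]
    [CompleteSpace E] {φ : E → ℝ} {x₀ v : E} (hφ : ContDiffAt ℝ 1 φ x₀)
    (hv : fderiv ℝ φ x₀ v = 1) :
    ∃ σ : E → E, σ 0 = x₀ ∧ ContDiffAt ℝ 1 σ 0 ∧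
      (∀ w, fderiv ℝ φ x₀ w = 0 → fderiv ℝ σ 0 w = w) ∧
      (∀ᶠ w in 𝓝 0, φ (σ w) = φ x₀) ∧
      ∀ V ∈ 𝓝 (0 : E), ∀ᶠ x in 𝓝 x₀, φ x = φ x₀ → x ∈ σ '' V := by
  set L := fderiv ℝ φ x₀ with hL
  have hφ' : HasFDerivAt φ L x₀ := (hφ.differentiableAt one_ne_zero).hasFDerivAt
  -- Moving $x$ along $v$ by the nonlinear remainder of `φ` gives $L(\Psi
  -- x-x_0)=\varphi(x)-\varphi(x_0)$, because $Lv=1$. The remainder has zero derivative at `x₀`, so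
  -- `Ψ` is a local diffeomorphism that flattens the level set into the hyperplane $x_0+\ker L$.
  let Ψ : E → E := fun x ↦ x + (φ x - φ x₀ - L (x - x₀)) • v
  have hΨ₀ : Ψ x₀ = x₀ := by simp [Ψ]
  have hΨ : ContDiffAt ℝ 1 Ψ x₀ := by
    refine contDiffAt_id.add (ContDiffAt.smul ?_ contDiffAt_const)
    refine (hφ.sub contDiffAt_const).sub ?_
    exact L.contDiff.contDiffAt.comp x₀ (contDiffAt_id.sub contDiffAt_const)
  have hΨ' : HasFDerivAt Ψ ((ContinuousLinearEquiv.refl ℝ E : E ≃L[ℝ] E) : E →L[ℝ] E) x₀ := by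
    have h1 : HasFDerivAt (fun x ↦ φ x - φ x₀ - L (x - x₀)) (L - L.comp (.id ℝ E)) x₀ :=
      (hφ'.sub_const _).sub (L.hasFDerivAt.comp x₀ ((hasFDerivAt_id x₀).sub_const x₀))
    have h2 := (hasFDerivAt_id x₀).add (h1.smul_const v)
    refine h2.congr_fderiv ?_
    ext w
    simp
  have hLΨ : ∀ x, L (Ψ x - x₀) = φ x - φ x₀ := by
    intro x
    simp only [Ψ, map_sub, map_add, map_smul, hv, smul_eq_mul]
    ring
  let inv : E → E := hΨ.localInverse hΨ' one_ne_zero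
  have hinv₀ : inv x₀ = x₀ := by
    have := hΨ.localInverse_apply_image hΨ' one_ne_zero
    rwa [hΨ₀] at this
  have hinv : ContDiffAt ℝ 1 inv x₀ := by
    have := hΨ.to_localInverse hΨ' one_ne_zero
    rwa [hΨ₀] at this
  have hstrict := hΨ.hasStrictFDerivAt' hΨ' one_ne_zero
  have hinv' : HasFDerivAt inv (.id ℝ E) x₀ := by
    have := hstrict.to_localInverse.hasFDerivAt
    rw [hΨ₀] at this
    exact this
  have hright : ∀ᶠ y in 𝓝 x₀, Ψ (inv y) = y := by
    have := hstrict.eventually_right_inverse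
    rwa [hΨ₀] at this
  have hleft : ∀ᶠ x in 𝓝 x₀, inv (Ψ x) = x := hstrict.eventually_left_inverse
  -- The projection onto $\ker L$ along `v`. Composing with it keeps the parameter in the whole
  -- space `E`, at the price of injectivity, which is not needed.
  let P : E →L[ℝ] E := .id ℝ E - L.smulRight v
  have hP : ∀ w, L w = 0 → P w = w := fun w hw ↦ by simp [P, hw]
  have hLP : ∀ w, L (P w) = 0 := fun w ↦ by simp [P, hv]
  have hτ : ContDiff ℝ 1 fun w ↦ x₀ + P w := contDiff_const.add P.contDiff
  have hτ' : HasFDerivAt (fun w ↦ x₀ + P w) P 0 := P.hasFDerivAt.const_add x₀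
  have hτ₀ : x₀ + P 0 = x₀ := by simp
  have hτt : Filter.Tendsto (fun w ↦ x₀ + P w) (𝓝 0) (𝓝 x₀) := by
    simpa [hτ₀] using hτ.continuous.tendsto 0
  refine ⟨fun w ↦ inv (x₀ + P w), by simp [hinv₀], ?_, ?_, ?_, ?_⟩
  · exact ContDiffAt.comp (0 : E) (by rwa [hτ₀]) hτ.contDiffAt
  · intro w hw
    have h : HasFDerivAt (fun w ↦ inv (x₀ + P w)) ((ContinuousLinearMap.id ℝ E).comp P) 0 :=
      HasFDerivAt.comp (0 : E) (by rwa [hτ₀]) hτ'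
    rw [h.fderiv]
    simp [hP w hw]
  · filter_upwards [hτt.eventually hright] with w hw
    have := hLΨ (inv (x₀ + P w))
    rw [hw, add_sub_cancel_left, hLP] at this
    linarith
  · intro V hV
    have ht : Filter.Tendsto (fun x ↦ Ψ x - x₀) (𝓝 x₀) (𝓝 0) := by
      have h := hΨ.continuousAt.tendsto.sub_const x₀
      rwa [hΨ₀, sub_self] at h
    filter_upwards [hleft, ht.eventually hV] with x hx hxV hφx
    refine ⟨Ψ x - x₀, hxV, ?_⟩
    have : L (Ψ x - x₀) = 0 := by rw [hLΨ, hφx, sub_self]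
    simp only [hP _ this, add_sub_cancel, hx]

/-! ### Calculus of directional derivatives. -/

variable {m : ℕ} {M : Type*} [TopologicalSpace M]
  [ChartedSpace (EuclideanSpace ℝ (Fin m)) M]

theorem dirDeriv_congr {f f' : M → ℝ} {p : M} (h : f =ᶠ[𝓝 p] f') (X : TangentSpace (𝓡 m) p) :
    dirDeriv f p X = dirDeriv f' p X := by
  have := h.eq_of_nhds
  simp only [dirDeriv, mvfderiv]
  rw [h.mfderiv_eq]
  rfl

theorem dirDeriv_comp {f : M → ℝ} {σ : EuclideanSpace ℝ (Fin m) → M}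
    {w : EuclideanSpace ℝ (Fin m)} (hf : MDifferentiableAt (𝓡 m) 𝓘(ℝ, ℝ) f (σ w))
    (hσ : MDifferentiableAt 𝓘(ℝ, EuclideanSpace ℝ (Fin m)) (𝓡 m) σ w)
    (u : EuclideanSpace ℝ (Fin m)) :
    fderiv ℝ (f ∘ σ) w u
      = dirDeriv f (σ w) (mfderiv 𝓘(ℝ, EuclideanSpace ℝ (Fin m)) (𝓡 m) σ w u) := by
  rw [← mfderiv_eq_fderiv]
  exact mvfderiv_comp_apply w hf hσ u

theorem dirDeriv_const (c : ℝ) (p : M) (X : TangentSpace (𝓡 m) p) :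
    dirDeriv (fun _ : M ↦ c) p X = 0 := by
  simp [dirDeriv, mvfderiv_const]

theorem dirDeriv_add {f f' : M → ℝ} {p : M} (hf : MDifferentiableAt (𝓡 m) 𝓘(ℝ, ℝ) f p)
    (hf' : MDifferentiableAt (𝓡 m) 𝓘(ℝ, ℝ) f' p) (X : TangentSpace (𝓡 m) p) :
    dirDeriv (fun q ↦ f q + f' q) p X = dirDeriv f p X + dirDeriv f' p X := by
  simp [dirDeriv, mvfderiv_fun_add hf hf']

theorem dirDeriv_mul {f f' : M → ℝ} {p : M} (hf : MDifferentiableAt (𝓡 m) 𝓘(ℝ, ℝ) f p)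
    (hf' : MDifferentiableAt (𝓡 m) 𝓘(ℝ, ℝ) f' p) (X : TangentSpace (𝓡 m) p) :
    dirDeriv (fun q ↦ f q * f' q) p X = f p * dirDeriv f' p X + f' p * dirDeriv f p X := by
  simp [dirDeriv, mvfderiv_fun_mul hf hf']

theorem dirDeriv_sub {f f' : M → ℝ} {p : M} (hf : MDifferentiableAt (𝓡 m) 𝓘(ℝ, ℝ) f p)
    (hf' : MDifferentiableAt (𝓡 m) 𝓘(ℝ, ℝ) f' p) (X : TangentSpace (𝓡 m) p) :
    dirDeriv (fun q ↦ f q - f' q) p X = dirDeriv f p X - dirDeriv f' p X := by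
  simp [dirDeriv, mvfderiv_fun_sub hf hf']

theorem dirDeriv_neg (f : M → ℝ) {p : M} (X : TangentSpace (𝓡 m) p) :
    dirDeriv (fun q ↦ - f q) p X = - dirDeriv f p X := by
  simp [dirDeriv, mvfderiv_fun_neg]

/-- The chain rule for a function of one real variable. -/
theorem dirDeriv_comp_real {f : M → ℝ} {h : ℝ → ℝ} {h' : ℝ} {p : M}
    (hf : MDifferentiableAt (𝓡 m) 𝓘(ℝ, ℝ) f p) (hh : HasDerivAt h h' (f p))
    (X : TangentSpace (𝓡 m) p) :
    dirDeriv (fun q ↦ h (f q)) p X = h' * dirDeriv f p X := by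
  have h1 : dirDeriv (h ∘ f) p X = mfderiv 𝓘(ℝ, ℝ) 𝓘(ℝ, ℝ) h (f p) (mfderiv (𝓡 m) 𝓘(ℝ, ℝ) f p X) :=
    mvfderiv_comp_apply p hh.differentiableAt.mdifferentiableAt hf X
  have h2 : dirDeriv f p X = mfderiv (𝓡 m) 𝓘(ℝ, ℝ) f p X := rfl
  change dirDeriv (h ∘ f) p X = _
  rw [h1, h2, mfderiv_eq_fderiv, hh.hasFDerivAt.fderiv]
  exact mul_comm _ _

theorem dirDeriv_log {f : M → ℝ} {p : M} (hf : MDifferentiableAt (𝓡 m) 𝓘(ℝ, ℝ) f p)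
    (h0 : f p ≠ 0) (X : TangentSpace (𝓡 m) p) :
    dirDeriv (fun q ↦ Real.log (f q)) p X = (f p)⁻¹ * dirDeriv f p X :=
  dirDeriv_comp_real hf (Real.hasDerivAt_log h0) X

variable [IsManifold (𝓡 m) ∞ M]

/-- The derivative of a function read in the preferred chart at a point. -/
theorem fderiv_comp_extChartAt_symm {f : M → ℝ} {p : M}
    (hf : MDifferentiableAt (𝓡 m) 𝓘(ℝ, ℝ) f p) (v : TangentSpace (𝓡 m) p) :
    fderiv ℝ (f ∘ (extChartAt (𝓡 m) p).symm) (extChartAt (𝓡 m) p p)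
      (mfderiv (𝓡 m) 𝓘(ℝ, EuclideanSpace ℝ (Fin m)) (extChartAt (𝓡 m) p) p v)
      = dirDeriv f p v := by
  set e := extChartAt (𝓡 m) p
  set x₀ := e p
  have hpe : e.symm x₀ = p := extChartAt_to_inv p
  have hsymm : MDifferentiableAt 𝓘(ℝ, EuclideanSpace ℝ (Fin m)) (𝓡 m) e.symm x₀ :=
    ((contMDiffOn_extChartAt_symm (I := 𝓡 m) (n := ∞) p).contMDiffAt
      (extChartAt_target_mem_nhds p)).mdifferentiableAt (by simp)
  have hde : MDifferentiableAt (𝓡 m) 𝓘(ℝ, EuclideanSpace ℝ (Fin m)) e p :=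
    mdifferentiableAt_extChartAt (mem_chart_source _ p)
  have hfe : MDifferentiableAt 𝓘(ℝ, EuclideanSpace ℝ (Fin m)) 𝓘(ℝ, ℝ) (f ∘ e.symm) x₀ :=
    MDifferentiableAt.comp x₀ (by rwa [hpe]) hsymm
  have h1 : dirDeriv ((f ∘ e.symm) ∘ e) p v = _ := mvfderiv_comp_apply p hfe hde v
  have h2 : (f ∘ e.symm) ∘ e =ᶠ[𝓝 p] f := by
    filter_upwards [extChartAt_source_mem_nhds (I := 𝓡 m) p] with q hq
    simp [e.left_inv hq]
  rw [← dirDeriv_congr h2, h1, ← mfderiv_eq_fderiv]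
  rfl

/-! ### Functions that are constant along a slice. -/

namespace TimelikeFoliation

variable {g : LorentzianMetric m M} (F : TimelikeFoliation g)

theorem dirDeriv_normal_ne_zero (p : M) : dirDeriv F.Φ p (F.n p) ≠ 0 := by
  intro h
  have := F.normal p (F.n p)
  rw [F.unit, h, mul_zero] at this
  exact one_ne_zero this

theorem tangent_iff (p : M) (X : TangentSpace (𝓡 m) p) :
    F.Tangent p X ↔ g.val p (F.n p) X = 0 := by
  have h1 : F.sgn ≠ 0 := by rcases F.sgn_eq with h | h <;> simp [h]
  rw [F.normal, Tangent]
  simp [h1, (F.φ_pos p).ne']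

/-- Local parametrization of a slice by a map from the model space. -/
theorem exists_slice_param (p : M) :
    ∃ σ : EuclideanSpace ℝ (Fin m) → M, σ 0 = p ∧
      (∀ᶠ w in 𝓝 0, MDifferentiableAt 𝓘(ℝ, EuclideanSpace ℝ (Fin m)) (𝓡 m) σ w) ∧
      (∀ X : TangentSpace (𝓡 m) p, F.Tangent p X →
        ∃ w : EuclideanSpace ℝ (Fin m), ∀ f : M → ℝ, MDifferentiableAt (𝓡 m) 𝓘(ℝ, ℝ) f p →
          fderiv ℝ (f ∘ σ) 0 w = dirDeriv f p X) ∧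
      (∀ᶠ w in 𝓝 0, F.Φ (σ w) = F.Φ p) ∧
      ∀ V ∈ 𝓝 (0 : EuclideanSpace ℝ (Fin m)), ∀ᶠ q in 𝓝 p, F.Φ q = F.Φ p → q ∈ σ '' V := by
  set e := extChartAt (𝓡 m) p
  set x₀ := e p
  have hpe : e.symm x₀ = p := extChartAt_to_inv p
  have hsymm : ContMDiffAt 𝓘(ℝ, EuclideanSpace ℝ (Fin m)) (𝓡 m) ∞ e.symm x₀ := by
    have := contMDiffOn_extChartAt_symm (I := 𝓡 m) (n := ∞) p
    exact this.contMDiffAt (extChartAt_target_mem_nhds p)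
  have hsymmd : MDifferentiableAt 𝓘(ℝ, EuclideanSpace ℝ (Fin m)) (𝓡 m) e.symm x₀ :=
    hsymm.mdifferentiableAt (by simp)
  have hdiff : ∀ f : M → ℝ, MDifferentiableAt (𝓡 m) 𝓘(ℝ, ℝ) f p →
      ∀ X : TangentSpace (𝓡 m) p, fderiv ℝ (f ∘ e.symm) x₀
        (mfderiv (𝓡 m) 𝓘(ℝ, EuclideanSpace ℝ (Fin m)) e p X) = dirDeriv f p X :=
    fun f hf X ↦ fderiv_comp_extChartAt_symm hf X
  have hΦp : MDifferentiableAt (𝓡 m) 𝓘(ℝ, ℝ) F.Φ p :=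
    (F.smooth_Φ p).mdifferentiableAt (by simp)
  have hΦe : ContDiffAt ℝ 1 (F.Φ ∘ e.symm) x₀ := by
    rw [← contMDiffAt_iff_contDiffAt]
    exact ((F.smooth_Φ _).comp x₀ hsymm).of_le (by simp)
  let v : EuclideanSpace ℝ (Fin m) := mfderiv (𝓡 m) 𝓘(ℝ, EuclideanSpace ℝ (Fin m)) e p (F.n p)
  -- The unit normal is transverse to the slice; rescaled by $1/n(\Phi)$ it has $\Phi$-derivative 1
  -- in the chart, as the straightening requires.
  obtain ⟨σ, hσ0, hσ, hσ', hσΦ, hσV⟩ := exists_levelSet_param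
    (v := (dirDeriv F.Φ p (F.n p))⁻¹ • v) hΦe (by
      have := hdiff F.Φ hΦp (F.n p)
      rw [map_smul]
      erw [this]
      exact inv_mul_cancel₀ (F.dirDeriv_normal_ne_zero p))
  have hσt : Filter.Tendsto σ (𝓝 0) (𝓝 x₀) := hσ0 ▸ hσ.continuousAt.tendsto
  refine ⟨e.symm ∘ σ, by simp [hσ0, hpe], ?_, ?_, ?_, ?_⟩
  · filter_upwards [hσ.eventually (by simp),
      hσt.eventually (extChartAt_target_mem_nhds (I := 𝓡 m) p)] with w hw hwt
    have h1 : MDifferentiableAt 𝓘(ℝ, EuclideanSpace ℝ (Fin m)) (𝓡 m) e.symm (σ w) :=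
      ((contMDiffOn_extChartAt_symm (I := 𝓡 m) (n := ∞) p).contMDiffAt
        ((isOpen_extChartAt_target p).mem_nhds hwt)).mdifferentiableAt (by simp)
    exact h1.comp w (hw.differentiableAt one_ne_zero).mdifferentiableAt
  · intro X hX
    refine ⟨mfderiv (𝓡 m) 𝓘(ℝ, EuclideanSpace ℝ (Fin m)) e p X, fun f hf ↦ ?_⟩
    have h0 := hdiff F.Φ hΦp X
    rw [show dirDeriv F.Φ p X = 0 from hX] at h0
    have hfe : MDifferentiableAt 𝓘(ℝ, EuclideanSpace ℝ (Fin m)) 𝓘(ℝ, ℝ) (f ∘ e.symm) x₀ :=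
      MDifferentiableAt.comp x₀ (by rwa [hpe]) hsymmd
    have hc : fderiv ℝ ((f ∘ e.symm) ∘ σ) 0 = (fderiv ℝ (f ∘ e.symm) (σ 0)).comp (fderiv ℝ σ 0) :=
      fderiv_comp 0 (by rw [hσ0]; exact hfe.differentiableAt) (hσ.differentiableAt one_ne_zero)
    change fderiv ℝ ((f ∘ e.symm) ∘ σ) 0 _ = _
    rw [hc, ← hdiff f hf X, hσ0]
    erw [ContinuousLinearMap.comp_apply, hσ' _ h0]
  · filter_upwards [hσΦ] with w hw
    simpa [hpe] using hw
  · intro V hV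
    have h1 := (continuousAt_extChartAt (I := 𝓡 m) p).eventually (hσV V hV)
    filter_upwards [h1, extChartAt_source_mem_nhds (I := 𝓡 m) p] with q hq hqs hΦ
    have hl : e.symm (e q) = q := e.left_inv hqs
    obtain ⟨w, hw, hwq⟩ := hq (by simp only [Function.comp]; rw [hl, hpe, hΦ])
    exact ⟨w, hw, by rw [Function.comp, hwq, hl]⟩

variable {F}

/-- A function that is constant along a slice near `p` has vanishing derivatives along it. -/
theorem dirDeriv_eq_zero_of_eventually_const {p : M} {f : M → ℝ} {c : ℝ}
    (hf : MDifferentiableAt (𝓡 m) 𝓘(ℝ, ℝ) f p)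
    (hc : ∀ᶠ q in 𝓝[F.slice (F.Φ p)] p, f q = c)
    {X : TangentSpace (𝓡 m) p} (hX : F.Tangent p X) : dirDeriv f p X = 0 := by
  obtain ⟨σ, hσ0, hσ, hσX, hσΦ, -⟩ := F.exists_slice_param p
  obtain ⟨w, hw⟩ := hσX X hX
  rw [← hw f hf]
  have hσt : Filter.Tendsto σ (𝓝 0) (𝓝 p) := hσ0 ▸ hσ.self_of_nhds.continuousAt.tendsto
  have : f ∘ σ =ᶠ[𝓝 0] fun _ ↦ c := by
    filter_upwards [hσt.eventually (eventually_nhdsWithin_iff.1 hc), hσΦ] with u hu hu'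
    exact hu hu'
  rw [this.fderiv_eq]
  simp

/-- A function whose derivatives along a slice vanish near `p` is constant along it near `p`. -/
theorem eventually_eq_of_sliceStationary {p : M} {f : M → ℝ}
    (hf : ∀ᶠ q in 𝓝[F.slice (F.Φ p)] p, MDifferentiableAt (𝓡 m) 𝓘(ℝ, ℝ) f q ∧
      F.SliceStationaryAt f q) :
    ∀ᶠ q in 𝓝[F.slice (F.Φ p)] p, f q = f p := by
  obtain ⟨σ, hσ0, hσ, -, hσΦ, hσV⟩ := F.exists_slice_param p
  have hσt : Filter.Tendsto σ (𝓝 0) (𝓝 p) := hσ0 ▸ hσ.self_of_nhds.continuousAt.tendsto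
  have h1 : ∀ᶠ w in 𝓝 (0 : EuclideanSpace ℝ (Fin m)),
      (DifferentiableAt ℝ (f ∘ σ) w ∧ fderiv ℝ (f ∘ σ) w = 0) := by
    filter_upwards [hσt.eventually (eventually_nhdsWithin_iff.1 hf), hσΦ.eventually_nhds, hσ]
      with w hw hw' hd
    obtain ⟨hfd, hst⟩ := hw hw'.self_of_nhds
    refine ⟨(hfd.comp w hd).differentiableAt, ?_⟩
    ext u
    rw [dirDeriv_comp hfd hd]
    -- The composite `F.Φ ∘ σ` is constant near `w`, so the range of the derivative of `σ` at `w` is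
    -- tangent to the slice and stationarity applies.
    refine hst _ ?_
    change dirDeriv F.Φ _ _ = 0
    rw [← dirDeriv_comp ((F.smooth_Φ _).mdifferentiableAt (by simp)) hd]
    have : F.Φ ∘ σ =ᶠ[𝓝 w] fun _ ↦ F.Φ p := hw'
    rw [this.fderiv_eq]
    simp
  obtain ⟨r, hr, hball⟩ := Metric.eventually_nhds_iff_ball.1 h1
  rw [eventually_nhdsWithin_iff]
  filter_upwards [hσV _ (Metric.ball_mem_nhds 0 hr)] with q hq hqs
  obtain ⟨w, hw, rfl⟩ := hq hqs
  -- The parametrizing ball is convex, hence a zero derivative there means constancy, and its image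
  -- covers a neighbourhood of `p` in the slice.
  have := (convex_ball (0 : EuclideanSpace ℝ (Fin m)) r).is_const_of_fderivWithin_eq_zero (𝕜 := ℝ)
    (f := f ∘ σ) (fun x hx ↦ (hball x hx).1.differentiableWithinAt)
    (fun x hx ↦ by rw [fderivWithin_of_isOpen Metric.isOpen_ball hx, (hball x hx).2])
    hw (Metric.mem_ball_self hr)
  simpa [hσ0] using this

end TimelikeFoliation

/-! ### Smooth vector fields and the Lie bracket. -/

/-- Smoothness at a point of a vector field. -/
def SmoothVectorFieldAt (Y : ∀ p : M, TangentSpace (𝓡 m) p) (p : M) : Prop :=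
  ContMDiffAt (𝓡 m) ((𝓡 m).prod 𝓘(ℝ, EuclideanSpace ℝ (Fin m))) ∞
    (fun q ↦ Bundle.TotalSpace.mk' (EuclideanSpace ℝ (Fin m))
      (E := fun p : M ↦ TangentSpace (𝓡 m) p) q (Y q)) p

theorem SmoothVectorFieldAt.diffAt {Y : ∀ p : M, TangentSpace (𝓡 m) p} {p : M}
    (hY : SmoothVectorFieldAt Y p) : VectorFieldDiffAt Y p :=
  ContMDiffAt.mdifferentiableAt hY (by simp)

theorem SmoothVectorField.diffAt {Y : ∀ p : M, TangentSpace (𝓡 m) p}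
    (hY : SmoothVectorField Y) (p : M) : VectorFieldDiffAt Y p :=
  (hY p).mdifferentiableAt (by simp)

theorem exists_smoothVectorFieldAt (p : M) (v : TangentSpace (𝓡 m) p) :
    ∃ Y : ∀ q : M, TangentSpace (𝓡 m) q, SmoothVectorFieldAt Y p ∧ Y p = v :=
  ⟨FiberBundle.extend (EuclideanSpace ℝ (Fin m)) v,
    FiberBundle.contMDiffAt_extend (𝓡 m) (EuclideanSpace ℝ (Fin m)) v, by simp⟩

theorem LorentzianMetric.contMDiffAt_val (g : LorentzianMetric m M)
    {Y Z : ∀ p : M, TangentSpace (𝓡 m) p} {p : M}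
    (hY : SmoothVectorFieldAt Y p) (hZ : SmoothVectorFieldAt Z p) :
    ContMDiffAt (𝓡 m) 𝓘(ℝ, ℝ) ∞ (fun q ↦ g.val q (Y q) (Z q)) p := by
  have : ContMDiffAt (𝓡 m) ((𝓡 m).prod 𝓘(ℝ)) ∞
      (fun q ↦ Bundle.TotalSpace.mk' ℝ (E := Bundle.Trivial M ℝ) q (g.val q (Y q) (Z q))) p := by
    apply ContMDiffAt.clm_bundle_apply₂ (F₁ := EuclideanSpace ℝ (Fin m))
      (F₂ := EuclideanSpace ℝ (Fin m))
    · exact g.contMDiff p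
    · exact hY
    · exact hZ
  simp only [Bundle.contMDiffAt_totalSpace] at this
  exact this.2

/-- The derivative of a smooth function along a smooth vector field is smooth. -/
theorem contMDiffAt_dirDeriv {f : M → ℝ} {Y : ∀ p : M, TangentSpace (𝓡 m) p} {p : M}
    (hf : ContMDiffAt (𝓡 m) 𝓘(ℝ, ℝ) ∞ f p) (hY : SmoothVectorFieldAt Y p) :
    ContMDiffAt (𝓡 m) 𝓘(ℝ, ℝ) ∞ (fun q ↦ dirDeriv f q (Y q)) p := by
  have h := hf.mfderiv_const (m := ∞) (by simp)
  have h2 := ContMDiffAt.clm_apply_of_inCoordinates (b₁ := id) (b₂ := f)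
    (ϕ := fun q ↦ mfderiv (𝓡 m) 𝓘(ℝ, ℝ) f q) h hY hf
  exact (contMDiff_snd_tangentBundle_modelSpace ℝ 𝓘(ℝ, ℝ)).contMDiffAt.comp p h2

/-- Differentiation along the Lie bracket of two vector fields is the commutator of the
differentiations along them. -/
theorem dirDeriv_mlieBracket {f : M → ℝ} {X Y : ∀ p : M, TangentSpace (𝓡 m) p} {p : M}
    (hf : ContMDiff (𝓡 m) 𝓘(ℝ, ℝ) ∞ f) (hX : SmoothVectorFieldAt X p)
    (hY : SmoothVectorFieldAt Y p) :
    dirDeriv f p (VectorField.mlieBracket (𝓡 m) X Y p)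
      = dirDeriv (fun q ↦ dirDeriv f q (Y q)) p (X p)
        - dirDeriv (fun q ↦ dirDeriv f q (X q)) p (Y p) := by
  set e := extChartAt (𝓡 m) p
  set x₀ := e p
  have hpe : e.symm x₀ = p := extChartAt_to_inv p
  have hsymm : ∀ x ∈ e.target, MDifferentiableAt 𝓘(ℝ, EuclideanSpace ℝ (Fin m)) (𝓡 m) e.symm x :=
    fun x hx ↦ ((contMDiffOn_extChartAt_symm (I := 𝓡 m) (n := ∞) p).contMDiffAt
      ((isOpen_extChartAt_target p).mem_nhds hx)).mdifferentiableAt (by simp)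
  have hsymm₀ : ContMDiffAt 𝓘(ℝ, EuclideanSpace ℝ (Fin m)) (𝓡 m) ∞ e.symm x₀ :=
    (contMDiffOn_extChartAt_symm (I := 𝓡 m) (n := ∞) p).contMDiffAt
      (extChartAt_target_mem_nhds p)
  have hx₀t : x₀ ∈ e.target := mem_extChartAt_target p
  have hchart : ∀ f : M → ℝ, MDifferentiableAt (𝓡 m) 𝓘(ℝ, ℝ) f p →
      ∀ v : TangentSpace (𝓡 m) p, fderiv ℝ (f ∘ e.symm) x₀
        (mfderiv (𝓡 m) 𝓘(ℝ, EuclideanSpace ℝ (Fin m)) e p v) = dirDeriv f p v :=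
    fun f hf v ↦ fderiv_comp_extChartAt_symm hf v
  -- Pulling the fields back by the chart turns their action on `f` into Fréchet derivatives of `f ∘
  -- e.symm`, and the claim into its known counterpart in the model space.
  let pull : (∀ p : M, TangentSpace (𝓡 m) p) →
      EuclideanSpace ℝ (Fin m) → EuclideanSpace ℝ (Fin m) := fun Z ↦
    VectorField.mpullback 𝓘(ℝ, EuclideanSpace ℝ (Fin m)) (𝓡 m) e.symm Z
  have hinv : ∀ x ∈ e.target,
      (mfderiv 𝓘(ℝ, EuclideanSpace ℝ (Fin m)) (𝓡 m) e.symm x).IsInvertible := by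
    intro x hx
    have := isInvertible_mfderivWithin_extChartAt_symm (I := 𝓡 m) hx
    rwa [ModelWithCorners.range_eq_univ, mfderivWithin_univ] at this
  have hpull : ∀ Z, ∀ x ∈ e.target, fderiv ℝ (f ∘ e.symm) x (pull Z x)
      = dirDeriv f (e.symm x) (Z (e.symm x)) := by
    intro Z x hx
    rw [dirDeriv_comp (hf.mdifferentiableAt (by simp)) (hsymm x hx)]
    have h := (hinv x hx).self_apply_inverse (Z (e.symm x))
    exact congrArg (dirDeriv f (e.symm x)) h
  have hpull₀ : ∀ Z, pull Z x₀ = mfderiv (𝓡 m) 𝓘(ℝ, EuclideanSpace ℝ (Fin m)) e p (Z p) := by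
    intro Z
    refine ((hinv x₀ hx₀t).inverse_apply_eq).2 ?_
    have h1 := mfderivWithin_extChartAt_symm_comp_mfderiv_extChartAt' (I := 𝓡 m)
      (mem_extChartAt_source (I := 𝓡 m) p)
    rw [ModelWithCorners.range_eq_univ, mfderivWithin_univ] at h1
    have h2 := congrArg (fun q ↦ (Z q : EuclideanSpace ℝ (Fin m))) hpe
    exact h2.trans (DFunLike.congr_fun h1 (Z p)).symm
  have hpulld : ∀ Z, SmoothVectorFieldAt Z p → DifferentiableAt ℝ (pull Z) x₀ := by
    intro Z hZ
    have := MDifferentiableWithinAt.differentiableWithinAt_mpullbackWithin_vectorField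
      (hZ.diffAt.mdifferentiableWithinAt (s := Set.univ))
    rw [Set.preimage_univ, Set.univ_inter, ModelWithCorners.range_eq_univ,
      VectorField.mpullbackWithin_univ] at this
    exact differentiableWithinAt_univ.1 this
  have hfe : ContDiffAt ℝ ∞ (f ∘ e.symm) x₀ := by
    rw [← contMDiffAt_iff_contDiffAt]
    exact (hf _).comp x₀ hsymm₀
  have hbr : mfderiv (𝓡 m) 𝓘(ℝ, EuclideanSpace ℝ (Fin m)) e p
      (VectorField.mlieBracket (𝓡 m) X Y p) = VectorField.lieBracket ℝ (pull X) (pull Y) x₀ := by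
    have h := VectorField.mlieBracketWithin_apply (I := 𝓡 m) (V := X) (W := Y) (s := Set.univ)
      (x₀ := p)
    rw [Set.preimage_univ, Set.univ_inter, ModelWithCorners.range_eq_univ,
      VectorField.mpullbackWithin_univ, VectorField.mpullbackWithin_univ,
      VectorField.mlieBracketWithin_univ] at h
    let L : EuclideanSpace ℝ (Fin m) := VectorField.lieBracket ℝ (pull X) (pull Y) x₀
    have h' : VectorField.mlieBracket (𝓡 m) X Y p
        = (mfderiv (𝓡 m) 𝓘(ℝ, EuclideanSpace ℝ (Fin m)) e p).inverse L := by
      simp only [L]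
      rw [← VectorField.lieBracketWithin_univ]
      exact h
    rw [h']
    exact (isInvertible_mfderiv_extChartAt (mem_extChartAt_source p)).self_apply_inverse _
  have hder : ∀ Z, SmoothVectorFieldAt Z p → ∀ v : TangentSpace (𝓡 m) p,
      dirDeriv (fun q ↦ dirDeriv f q (Z q)) p v =
      fderiv ℝ (fun x ↦ fderiv ℝ (f ∘ e.symm) x (pull Z x)) x₀ (mfderiv (𝓡 m) 𝓘(ℝ, EuclideanSpace ℝ (Fin m)) e p v) := by
    intro Z hZ v
    rw [← hchart _ ((contMDiffAt_dirDeriv (hf p) hZ).mdifferentiableAt (by simp))]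
    congr 1
    refine Filter.EventuallyEq.fderiv_eq ?_
    filter_upwards [extChartAt_target_mem_nhds (I := 𝓡 m) p] with x hx
    exact (hpull Z x hx).symm
  rw [← hchart f (hf.mdifferentiableAt (by simp)), hbr, hder X hX, hder Y hY, ← hpull₀, ← hpull₀]
  exact VectorField.fderiv_apply_lieBracket hfe
    (by rw [minSmoothness_of_isRCLikeNormedField]; exact ENat.LEInfty.out) (hpulld Y hY) (hpulld X hX)

variable {g : LorentzianMetric m M}
  {nabla : CovariantDerivative (𝓡 m) (EuclideanSpace ℝ (Fin m))
    (fun p : M ↦ TangentSpace (𝓡 m) p)}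

/-! ### Symmetry of the second fundamental form. -/

namespace TimelikeFoliation

variable (F : TimelikeFoliation g)

theorem secondForm_of_tangent {p : M} {X Y : TangentSpace (𝓡 m) p} (hX : F.Tangent p X)
    (hY : F.Tangent p Y) : F.secondForm nabla p X Y = g.val p (nabla F.n p X) Y := by
  rw [F.tangent_iff] at hX hY
  simp [secondForm, proj, hX, hY]

/-- The second fundamental form is symmetric. -/
theorem secondForm_symm (hnabla : IsLeviCivita g nabla) {p : M} {X Y : TangentSpace (𝓡 m) p}
    (hX : F.Tangent p X) (hY : F.Tangent p Y) :
    F.secondForm nabla p X Y = F.secondForm nabla p Y X := by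
  rw [F.secondForm_of_tangent hX hY, F.secondForm_of_tangent hY hX]
  obtain ⟨X', hX', rfl⟩ := exists_smoothVectorFieldAt p X
  obtain ⟨Y', hY', rfl⟩ := exists_smoothVectorFieldAt p Y
  -- This is the derivative of $n_\alpha Z^\alpha=\pm\varphi\,Z(\Phi)$. The derivative of the lapse
  -- drops out because $Z(\Phi)=0$ at `p`; tangency elsewhere is not required.
  have key : ∀ Z : ∀ q : M, TangentSpace (𝓡 m) q, SmoothVectorFieldAt Z p → F.Tangent p (Z p) →
      ∀ v : TangentSpace (𝓡 m) p, g.val p (nabla F.n p v) (Z p) + g.val p (F.n p) (nabla Z p v)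
        = F.sgn * F.φ p * dirDeriv (fun q ↦ dirDeriv F.Φ q (Z q)) p v := by
    intro Z hZ hZt v
    rw [← hnabla.2 p F.n Z (F.smooth_n.diffAt p) hZ.diffAt v]
    have h1 : (fun q ↦ g.val q (F.n q) (Z q))
        = fun q ↦ F.sgn * F.φ q * dirDeriv F.Φ q (Z q) := by
      funext q
      exact F.normal q (Z q)
    have hs : MDifferentiableAt (𝓡 m) 𝓘(ℝ, ℝ) (fun q ↦ F.sgn * F.φ q) p :=
      ((contMDiffAt_const (c := F.sgn)).mul (F.smooth_φ p)).mdifferentiableAt (by simp)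
    rw [h1, dirDeriv_mul hs ((contMDiffAt_dirDeriv (F.smooth_Φ p) hZ).mdifferentiableAt (by simp)),
      show dirDeriv F.Φ p (Z p) = 0 from hZt, zero_mul, add_zero]
  have hXY := key X' hX' hX (Y' p)
  have hYX := key Y' hY' hY (X' p)
  -- Vanishing torsion turns the difference of the $\nabla Z$ terms into the bracket, whose normal
  -- component is the commutator of the second derivatives of `F.Φ`. The two cancel, leaving the
  -- symmetry.
  have htor := nabla.torsion_eq_zero_iff.1 hnabla.1 hX'.diffAt hY'.diffAt
  have hbr := F.normal p (VectorField.mlieBracket (𝓡 m) X' Y' p)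
  rw [dirDeriv_mlieBracket F.smooth_Φ hX' hY', ← htor, map_sub] at hbr
  linear_combination hYX - hXY - hbr

end TimelikeFoliation

/-! ### The Gram matrix of the conformal Killing fields. -/

variable {F : TimelikeFoliation g} {K : Fin 2 → ∀ p : M, TangentSpace (𝓡 m) p}

theorem gram_apply (a b : Fin 2) (p : M) : gram g K p a b = g.val p (K a p) (K b p) := rfl

theorem gram_comm (a b : Fin 2) (p : M) : gram g K p a b = gram g K p b a := g.symm p _ _

/-- The normal derivative of the Gram matrix of conformal Killing fields tangent to the slices is
twice the second fundamental form. -/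
theorem IsTangentConformalPair.normalDeriv_gram (hnabla : IsLeviCivita g nabla)
    (hK : IsTangentConformalPair g nabla F K) (a b : Fin 2) (p : M) :
    F.normalDeriv (fun q ↦ gram g K q a b) p = 2 * F.secondForm nabla p (K a p) (K b p) := by
  -- The conformal factor disappears because $n\perp\mathcal K_b$, so $\langle\nabla_n\mathcal
  -- K_a,\mathcal K_b\rangle=-\langle n,\nabla_{\mathcal K_b}\mathcal K_a\rangle$. Differentiating
  -- $\langle n,\mathcal K_a\rangle=0$ along $\mathcal K_b$ moves the derivative onto `F.n`.
  have key : ∀ a b : Fin 2, g.val p (nabla (K a) p (F.n p)) (K b p)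
      = F.secondForm nabla p (K b p) (K a p) := by
    intro a b
    have h1 := hK.killing a p (F.n p) (K b p)
    rw [(F.tangent_iff p _).1 (hK.tangent b p), mul_zero] at h1
    have h2 := hnabla.2 p F.n (K a) (F.smooth_n.diffAt p) ((hK.smooth a).diffAt p) (K b p)
    have h3 : (fun q ↦ g.val q (F.n q) (K a q)) = fun _ ↦ 0 := by
      funext q
      exact (F.tangent_iff q _).1 (hK.tangent a q)
    rw [h3, dirDeriv_const] at h2
    rw [F.secondForm_of_tangent (hK.tangent b p) (hK.tangent a p)]
    linarith
  have h := hnabla.2 p (K a) (K b) ((hK.smooth a).diffAt p) ((hK.smooth b).diffAt p) (F.n p)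
  change dirDeriv (fun q ↦ g.val q (K a q) (K b q)) p (F.n p) = _
  rw [h, key, g.symm, key, F.secondForm_symm hnabla (hK.tangent b p) (hK.tangent a p)]
  ring

theorem IsTangentConformalPair.contMDiffAt_gram (hK : IsTangentConformalPair g nabla F K)
    (a b : Fin 2) (p : M) : ContMDiffAt (𝓡 m) 𝓘(ℝ, ℝ) ∞ (fun q ↦ gram g K q a b) p :=
  g.contMDiffAt_val (hK.smooth a p) (hK.smooth b p)

theorem IsTangentConformalPair.contMDiffAt_det (hK : IsTangentConformalPair g nabla F K)
    (p : M) : ContMDiffAt (𝓡 m) 𝓘(ℝ, ℝ) ∞ (fun q ↦ (gram g K q).det) p := by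
  simp only [Matrix.det_fin_two]
  exact ((hK.contMDiffAt_gram 0 0 p).mul (hK.contMDiffAt_gram 1 1 p)).sub
    ((hK.contMDiffAt_gram 0 1 p).mul (hK.contMDiffAt_gram 1 0 p))

theorem IsTangentConformalPair.isOpen_regularSet (hK : IsTangentConformalPair g nabla F K) :
    IsOpen (regularSet g K) :=
  isOpen_lt (continuous_iff_continuousAt.2 fun p ↦ (hK.contMDiffAt_det p).continuousAt)
    continuous_const

theorem IsTangentConformalPair.normalDeriv_det (hK : IsTangentConformalPair g nabla F K) (p : M) :
    F.normalDeriv (fun q ↦ (gram g K q).det) p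
      = gram g K p 0 0 * F.normalDeriv (fun q ↦ gram g K q 1 1) p
        + gram g K p 1 1 * F.normalDeriv (fun q ↦ gram g K q 0 0) p
        - (gram g K p 0 1 * F.normalDeriv (fun q ↦ gram g K q 1 0) p
        + gram g K p 1 0 * F.normalDeriv (fun q ↦ gram g K q 0 1) p) := by
  have hd : ∀ a b, MDifferentiableAt (𝓡 m) 𝓘(ℝ, ℝ) (fun q ↦ gram g K q a b) p :=
    fun a b ↦ (hK.contMDiffAt_gram a b p).mdifferentiableAt (by simp)
  have hd2 : ∀ a b a' b', MDifferentiableAt (𝓡 m) 𝓘(ℝ, ℝ)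
      (fun q ↦ gram g K q a b * gram g K q a' b') p :=
    fun a b a' b' ↦ ((hK.contMDiffAt_gram a b p).mul
      (hK.contMDiffAt_gram a' b' p)).mdifferentiableAt (by simp)
  simp only [Matrix.det_fin_two, TimelikeFoliation.normalDeriv]
  rw [dirDeriv_sub (hd2 _ _ _ _) (hd2 _ _ _ _), dirDeriv_mul (hd _ _) (hd _ _),
    dirDeriv_mul (hd _ _) (hd _ _)]

theorem IsTangentConformalPair.normalDeriv_log_det (hK : IsTangentConformalPair g nabla F K)
    {p : M} (hp : p ∈ regularSet g K) :
    F.normalDeriv (fun q ↦ Real.log (gram g K q).det) p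
      = (gram g K p).det⁻¹ * F.normalDeriv (fun q ↦ (gram g K q).det) p :=
  dirDeriv_log ((hK.contMDiffAt_det p).mdifferentiableAt (by simp)) (ne_of_lt hp) _

/-- At a regular point, a vector tangent to the slice splits into a part in the span of
`K_1`, `K_2` and a part in the orthogonal complement. -/
theorem IsTangentConformalPair.exists_decomposition (hK : IsTangentConformalPair g nabla F K)
    {p : M} (hp : p ∈ regularSet g K) {X : TangentSpace (𝓡 m) p} (hX : F.Tangent p X) :
    ∃ (x : Fin 2 → ℝ) (X' : TangentSpace (𝓡 m) p), IsComplementary F K p X' ∧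
      X = x 0 • K 0 p + x 1 • K 1 p + X' := by
  have hdet : IsUnit (gram g K p).det := isUnit_iff_ne_zero.2 (ne_of_lt hp)
  let w : Fin 2 → ℝ := fun a ↦ g.val p (K a p) X
  let x : Fin 2 → ℝ := (gram g K p)⁻¹ *ᵥ w
  have hx : gram g K p *ᵥ x = w := by
    rw [Matrix.mulVec_mulVec, Matrix.mul_nonsing_inv _ hdet, Matrix.one_mulVec]
  refine ⟨x, X - (x 0 • K 0 p + x 1 • K 1 p), ⟨?_, fun a ↦ ?_⟩, by abel⟩
  · have h0 := (F.tangent_iff p _).1 (hK.tangent 0 p)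
    have h1 := (F.tangent_iff p _).1 (hK.tangent 1 p)
    have h2 := (F.tangent_iff p _).1 hX
    rw [F.tangent_iff]
    simp [h0, h1, h2]
  · have h := congrFun hx a
    simp only [Matrix.mulVec, dotProduct, Fin.sum_univ_two, gram_apply] at h
    simp only [map_sub, map_add, map_smul, smul_eq_mul]
    have : w a = g.val p (K a p) X := rfl
    linarith

theorem IsTangentConformalPair.masterMatrix_comm (hnabla : IsLeviCivita g nabla)
    (hK : IsTangentConformalPair g nabla F K) (χ : M → ℝ) (a b : Fin 2) (p : M) :
    masterMatrix F K χ p a b = masterMatrix F K χ p b a := by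
  simp only [masterMatrix, Matrix.of_apply, hK.normalDeriv_gram hnabla,
    F.secondForm_symm hnabla (hK.tangent a p) (hK.tangent b p), gram_comm a b]

/-- Where the master equation is vacuous, the slice is totally umbilic. -/
theorem isUmbilicAt_of_masterMatrix_eq_zero (hnabla : IsLeviCivita g nabla)
    (hK : IsTangentConformalPair g nabla F K) {χ : M → ℝ} {p : M} (hp : p ∈ regularSet g K)
    (hχp : χ p ≠ 0) (hu : IsPartiallyUmbilicAt nabla F K χ p)
    (hM : masterMatrix F K χ p = 0) : F.IsUmbilicAt nabla p := by
  have hdet : (gram g K p).det ≠ 0 := ne_of_lt hp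
  set ℓ := F.normalDeriv (fun q ↦ Real.log (gram g K q).det) p with hℓ
  have h1 : ∀ a b, F.secondForm nabla p (K a p) (K b p) = (ℓ / 2 - χ p) * gram g K p a b := by
    intro a b
    have h := congrFun (congrFun hM a) b
    simp only [masterMatrix, Matrix.of_apply, hK.normalDeriv_gram hnabla, Matrix.zero_apply,
      ← hℓ] at h
    field_simp at h
    linarith
  -- If the Gram block of the second form is $(\ell/2-\chi)\mathcal G_{ab}$, Jacobi's formula for
  -- the $2\times2$ determinant gives $\ell=4(\ell/2-\chi)$. Thus the block has factor
  -- $\ell/2-\chi=\chi$, the same as on the orthogonal complement.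
  have h2 : ℓ = 4 * χ p := by
    have h3 := hK.normalDeriv_log_det hp
    rw [← hℓ, hK.normalDeriv_det] at h3
    simp only [hK.normalDeriv_gram hnabla, h1] at h3
    have h4 : ℓ = (gram g K p).det⁻¹ * ((gram g K p).det * (4 * (ℓ / 2 - χ p))) := by
      refine h3.trans ?_
      rw [Matrix.det_fin_two]
      ring
    rw [inv_mul_cancel_left₀ hdet] at h4
    linarith
  have h5 : ∀ a b, g.val p (nabla F.n p (K a p)) (K b p) = χ p * g.val p (K a p) (K b p) := by
    intro a b
    rw [← F.secondForm_of_tangent (hK.tangent a p) (hK.tangent b p), h1, h2, gram_apply]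
    ring
  refine ⟨χ p, fun X Y hX hY ↦ ?_⟩
  rw [F.secondForm_of_tangent hX hY]
  obtain ⟨x, X', hX', rfl⟩ := hK.exists_decomposition hp hX
  obtain ⟨y, Y', hY', rfl⟩ := hK.exists_decomposition hp hY
  have hKX : ∀ a, g.val p (nabla F.n p (K a p)) Y' = 0 := fun a ↦ by
    rw [← F.secondForm_of_tangent (hK.tangent a p) hY'.1, hu.1 a Y' hY']
  have hXK : ∀ a, g.val p (nabla F.n p X') (K a p) = 0 := fun a ↦ by
    rw [← F.secondForm_of_tangent hX'.1 (hK.tangent a p),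
      F.secondForm_symm hnabla hX'.1 (hK.tangent a p), hu.1 a X' hX']
  have hXY : g.val p (nabla F.n p X') Y' = χ p * g.val p X' Y' := by
    rw [← F.secondForm_of_tangent hX'.1 hY'.1, hu.2 X' Y' hX' hY']
  have hX'K : ∀ a, g.val p X' (K a p) = 0 := fun a ↦ by rw [g.symm, hX'.2 a]
  simp only [map_add, map_smul, add_apply, smul_apply,
    smul_eq_mul, h5, hKX, hXK, hXY, hX'K, hY'.2]
  ring

/-! ### The conserved density and the master matrix. -/

variable {χ : M → ℝ}

theorem gramInv_eq (a b : Fin 2) (p : M) :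
    gramInv g K a b p = (gram g K p).det⁻¹ * (gram g K p).adjugate a b := by
  simp [gramInv, Matrix.inv_def]

theorem IsTangentConformalPair.contMDiffAt_gramInv (hK : IsTangentConformalPair g nabla F K)
    (a b : Fin 2) {p : M} (hp : p ∈ regularSet g K) :
    ContMDiffAt (𝓡 m) 𝓘(ℝ, ℝ) ∞ (gramInv g K a b) p := by
  have h : gramInv g K a b = fun q ↦ (gram g K q).det⁻¹ * (gram g K q).adjugate a b :=
    funext (gramInv_eq a b)
  rw [h]
  refine ((hK.contMDiffAt_det p).inv₀ (ne_of_lt hp)).mul ?_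
  fin_cases a <;> fin_cases b
  · simpa [Matrix.adjugate_fin_two] using hK.contMDiffAt_gram 1 1 p
  · simpa [Matrix.adjugate_fin_two] using (hK.contMDiffAt_gram 0 1 p).neg
  · simpa [Matrix.adjugate_fin_two] using (hK.contMDiffAt_gram 1 0 p).neg
  · simpa [Matrix.adjugate_fin_two] using hK.contMDiffAt_gram 0 0 p

variable (F K χ) in
/-- The matrix `𝒢^{ab} + (2χ)⁻¹ n^α ∇_α 𝒢^{ab}`. -/
noncomputable def liftMatrix (a b : Fin 2) (p : M) : ℝ :=
  gramInv g K a b p + 1 / (2 * χ p) * F.normalDeriv (gramInv g K a b) p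

/-- The matrix of the master equation is, up to a factor, the adjugate of `liftMatrix`. -/
theorem IsTangentConformalPair.masterMatrix_adjugate (hK : IsTangentConformalPair g nabla F K)
    (a b : Fin 2) {p : M} (hp : p ∈ regularSet g K) :
    (masterMatrix F K χ p).adjugate a b = (gram g K p).det * liftMatrix F K χ a b p := by
  have hdet : (gram g K p).det ≠ 0 := ne_of_lt hp
  have hd : MDifferentiableAt (𝓡 m) 𝓘(ℝ, ℝ) (fun q ↦ (gram g K q).det) p :=
    (hK.contMDiffAt_det p).mdifferentiableAt (by simp)
  have hdi : MDifferentiableAt (𝓡 m) 𝓘(ℝ, ℝ) (fun q ↦ (gram g K q).det⁻¹) p :=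
    ((hK.contMDiffAt_det p).inv₀ hdet).mdifferentiableAt (by simp)
  have hg : ∀ a b, MDifferentiableAt (𝓡 m) 𝓘(ℝ, ℝ) (fun q ↦ gram g K q a b) p :=
    fun a b ↦ (hK.contMDiffAt_gram a b p).mdifferentiableAt (by simp)
  have hinv : dirDeriv (fun q ↦ (gram g K q).det⁻¹) p (F.n p)
      = -((gram g K p).det ^ 2)⁻¹ * F.normalDeriv (fun q ↦ (gram g K q).det) p :=
    dirDeriv_comp_real hd (hasDerivAt_inv hdet) _
  have key : ∀ a b, F.normalDeriv (fun q ↦ (gram g K q).det⁻¹ * gram g K q a b) p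
      = (gram g K p).det⁻¹ * F.normalDeriv (fun q ↦ gram g K q a b) p
        + gram g K p a b
          * (-((gram g K p).det ^ 2)⁻¹ * F.normalDeriv (fun q ↦ (gram g K q).det) p) := by
    intro a b
    rw [← hinv]
    exact dirDeriv_mul hdi (hg a b) _
  have keyn : ∀ a b, F.normalDeriv (fun q ↦ -((gram g K q).det⁻¹ * gram g K q a b)) p
      = -F.normalDeriv (fun q ↦ (gram g K q).det⁻¹ * gram g K q a b) p :=
    fun a b ↦ dirDeriv_neg _ _
  have h : gramInv g K a b = fun q ↦ (gram g K q).det⁻¹ * (gram g K q).adjugate a b :=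
    funext (gramInv_eq a b)
  -- Writing $\mathcal G^{ab}$ as $\mathcal G^{-1}$ times the adjugate, the derivative of $\mathcal
  -- G^{-1}$ supplies exactly the $n^\alpha\nabla_\alpha\ln\mathcal G$ term of the master matrix.
  rw [liftMatrix, h]
  simp only [Matrix.adjugate_fin_two]
  fin_cases a <;> fin_cases b <;>
  · simp [key, keyn, masterMatrix, hK.normalDeriv_log_det hp]
    field_simp
    ring

variable (F K χ) in
/-- The density `χ φ³ (𝒢^{ab} + (2χ)⁻¹ n^α ∇_α 𝒢^{ab})`, which is constant along the slices. -/
noncomputable def liftDensity (a b : Fin 2) (p : M) : ℝ :=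
  χ p * F.φ p ^ 3 * liftMatrix F K χ a b p

theorem liftDensity_mdifferentiableAt (hK : IsTangentConformalPair g nabla F K)
    (hχ : SatisfiesLiftConditions nabla F K χ) {p : M} (hp : p ∈ regularSet g K)
    (hχp : χ p ≠ 0) (a b : Fin 2) :
    MDifferentiableAt (𝓡 m) 𝓘(ℝ, ℝ) (fun q ↦ χ q * F.φ q ^ 3) p ∧
    MDifferentiableAt (𝓡 m) 𝓘(ℝ, ℝ) (liftMatrix F K χ a b) p := by
  have h1 : ContMDiffAt (𝓡 m) 𝓘(ℝ, ℝ) ∞ χ p :=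
    hχ.smooth_χ.contMDiffAt (hK.isOpen_regularSet.mem_nhds hp)
  have h2 := hK.contMDiffAt_gramInv a b hp
  have h3 : ContMDiffAt (𝓡 m) 𝓘(ℝ, ℝ) ∞ (F.normalDeriv (gramInv g K a b)) p :=
    contMDiffAt_dirDeriv h2 (F.smooth_n p)
  have h4 : ContMDiffAt (𝓡 m) 𝓘(ℝ, ℝ) ∞ (fun q ↦ 1 / (2 * χ q)) p := by
    simp only [one_div]
    exact ((contMDiffAt_const (c := (2 : ℝ))).mul h1).inv₀ (mul_ne_zero two_ne_zero hχp)
  exact ⟨(h1.mul ((F.smooth_φ p).pow 3)).mdifferentiableAt (by simp),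
    (h2.add (h4.mul h3)).mdifferentiableAt (by simp)⟩

/-- In the product rule, the derivative of the factor $\chi\varphi^3$ cancels the logarithmic
derivative on the right of condition 3. -/
theorem liftDensity_sliceStationaryAt (hK : IsTangentConformalPair g nabla F K)
    (hχ : SatisfiesLiftConditions nabla F K χ) {p : M} (hp : p ∈ regularSet g K)
    (hχp : χ p ≠ 0) (a b : Fin 2) :
    F.SliceStationaryAt (liftDensity F K χ a b) p := by
  intro X hX
  obtain ⟨h1, h2⟩ := liftDensity_mdifferentiableAt hK hχ hp hχp a b
  have h0 : χ p * F.φ p ^ 3 ≠ 0 := mul_ne_zero hχp (pow_ne_zero _ (F.φ_pos p).ne')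
  have h3 : dirDeriv (liftMatrix F K χ a b) p X
      = - dirDeriv (fun q ↦ Real.log (χ q * F.φ q ^ 3)) p X * liftMatrix F K χ a b p :=
    hχ.integrable_gram p hp hχp a b X hX
  have h4 : dirDeriv (liftDensity F K χ a b) p X = _ := dirDeriv_mul h1 h2 X
  rw [h4, h3, dirDeriv_log h1 h0]
  linear_combination (-liftMatrix F K χ a b p * dirDeriv (fun q ↦ χ q * F.φ q ^ 3) p X)
    * mul_inv_cancel₀ h0

/-- Along a slice, the matrix of the master equation is locally constant up to a factor. -/
theorem eventually_masterMatrix_eq_smul (hK : IsTangentConformalPair g nabla F K)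
    (hχ : SatisfiesLiftConditions nabla F K χ) {s : ℝ}
    (hχ0 : ∀ p ∈ F.slice s ∩ regularSet g K, χ p ≠ 0) {p : M}
    (hp : p ∈ F.slice s ∩ regularSet g K) :
    ∀ᶠ q in 𝓝[F.slice s] p, ∃ c : ℝ, c ≠ 0 ∧
      masterMatrix F K χ q = c • masterMatrix F K χ p := by
  have hs : F.Φ p = s := hp.1
  have hreg : ∀ᶠ q in 𝓝[F.slice s] p, q ∈ F.slice s ∩ regularSet g K :=
    Filter.inter_mem self_mem_nhdsWithin
      (mem_nhdsWithin_of_mem_nhds (hK.isOpen_regularSet.mem_nhds hp.2))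
  have hconst : ∀ a b, ∀ᶠ q in 𝓝[F.slice s] p,
      liftDensity F K χ a b q = liftDensity F K χ a b p := by
    intro a b
    have := TimelikeFoliation.eventually_eq_of_sliceStationary (F := F) (p := p)
      (f := liftDensity F K χ a b) (by
        rw [hs]
        filter_upwards [hreg] with q hq
        obtain ⟨h1, h2⟩ := liftDensity_mdifferentiableAt hK hχ hq.2 (hχ0 q hq) a b
        exact ⟨h1.mul h2, liftDensity_sliceStationaryAt hK hχ hq.2 (hχ0 q hq) a b⟩)
    rwa [hs] at this
  have hall : ∀ᶠ q in 𝓝[F.slice s] p, ∀ a b,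
      liftDensity F K χ a b q = liftDensity F K χ a b p := by
    simp only [Filter.eventually_all]
    exact hconst
  have hne : ∀ q ∈ F.slice s ∩ regularSet g K, χ q * F.φ q ^ 3 * (gram g K q).det⁻¹ ≠ 0 :=
    fun q hq ↦ mul_ne_zero (mul_ne_zero (hχ0 q hq) (pow_ne_zero _ (F.φ_pos q).ne'))
      (inv_ne_zero (ne_of_lt hq.2))
  have hdens : ∀ q ∈ F.slice s ∩ regularSet g K, ∀ a b, liftDensity F K χ a b q
      = (χ q * F.φ q ^ 3 * (gram g K q).det⁻¹) * (masterMatrix F K χ q).adjugate a b := by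
    intro q hq a b
    have : (gram g K q).det ≠ 0 := ne_of_lt hq.2
    rw [hK.masterMatrix_adjugate a b hq.2, liftDensity]
    field_simp
  filter_upwards [hreg, hall] with q hq hall
  set cq := χ q * F.φ q ^ 3 * (gram g K q).det⁻¹ with hcq
  set cp := χ p * F.φ p ^ 3 * (gram g K p).det⁻¹ with hcp
  refine ⟨cq⁻¹ * cp, mul_ne_zero (inv_ne_zero (hne q hq)) (hne p hp), ?_⟩
  have hadj : (masterMatrix F K χ q).adjugate = (cq⁻¹ * cp) • (masterMatrix F K χ p).adjugate := by
    ext a b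
    have h := hall a b
    rw [hdens q hq, hdens p hp, ← hcq, ← hcp] at h
    rw [Matrix.smul_apply, smul_eq_mul, mul_assoc, ← h, inv_mul_cancel_left₀ (hne q hq)]
  -- A $2\times2$ adjugate merely permutes entries up to sign, so proportionality passes back to the
  -- matrices themselves, with the same factor.
  have h00 := congrFun (congrFun hadj 0) 0
  have h01 := congrFun (congrFun hadj 0) 1
  have h10 := congrFun (congrFun hadj 1) 0
  have h11 := congrFun (congrFun hadj 1) 1
  simp only [Matrix.adjugate_fin_two, Matrix.smul_apply, smul_eq_mul, Matrix.of_apply,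
    Matrix.cons_val', Matrix.cons_val_zero, Matrix.cons_val_one, Matrix.cons_val_fin_one,
    mul_neg, neg_inj] at h00 h01 h10 h11
  ext a b
  rw [Matrix.smul_apply, smul_eq_mul]
  fin_cases a <;> fin_cases b
  exacts [h11, h01, h10, h00]

theorem masterEq_iff (p : M) (v : Fin 2 → ℝ) :
    MasterEq F K χ p v ↔ v 0 * masterMatrix F K χ p 0 0 * v 0 + v 0 * masterMatrix F K χ p 0 1 * v 1
      + (v 1 * masterMatrix F K χ p 1 0 * v 0 + v 1 * masterMatrix F K χ p 1 1 * v 1) = 0 := by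
  simp [MasterEq, Fin.sum_univ_two]

/-- Along a slice, the master equation has locally the same solutions at all points. -/
theorem eventually_masterEq_iff (hK : IsTangentConformalPair g nabla F K)
    (hχ : SatisfiesLiftConditions nabla F K χ) {s : ℝ}
    (hχ0 : ∀ p ∈ F.slice s ∩ regularSet g K, χ p ≠ 0) {p : M}
    (hp : p ∈ F.slice s ∩ regularSet g K) :
    ∀ᶠ q in 𝓝[F.slice s] p, ∀ v, MasterEq F K χ q v ↔ MasterEq F K χ p v := by
  filter_upwards [eventually_masterMatrix_eq_smul hK hχ hχ0 hp] with q ⟨c, hc, hq⟩ v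
  have : ∑ a, ∑ b, v a * masterMatrix F K χ q a b * v b
      = c * ∑ a, ∑ b, v a * masterMatrix F K χ p a b * v b := by
    simp only [hq, Matrix.smul_apply, smul_eq_mul, Finset.mul_sum]
    exact Finset.sum_congr rfl fun a _ ↦ Finset.sum_congr rfl fun b _ ↦ by ring
  rw [MasterEq, MasterEq, this, mul_eq_zero, or_iff_right hc]

/-! ### Compactness of the spatial sections. -/

theorem impactNormSq_eq (p : M) (v : Fin 2 → ℝ) :
    impactNormSq g K p v = v 0 * v 0 * gram g K p 0 0 + 2 * (v 0 * v 1 * gram g K p 0 1)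
      + v 1 * v 1 * gram g K p 1 1 := by
  simp only [impactNormSq, Fin.sum_univ_two, map_add, map_smul, add_apply, smul_apply, smul_eq_mul,
    gram_apply, g.symm p (K 1 p) (K 0 p)]
  ring

/-- A relatively closed set of regular points of a slice with compact spatial sections determines
a non-timelike subdomain with compact spatial sections. -/
theorem hasCompactSpatialSections_photonDomain (hK : IsTangentConformalPair g nabla F K) {s : ℝ}
    (hcompact : F.HasCompactSpatialSections (F.slice s)) {D : Set M}
    (hDs : D ⊆ F.slice s ∩ regularSet g K)
    (hD : ∀ p ∈ F.slice s ∩ regularSet g K, p ∈ closure D → p ∈ D) {ρ : M → Fin 2 → ℝ}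
    (hρ : ∀ p ∈ D, ContinuousAt ρ p) :
    F.HasCompactSpatialSections (photonDomain F K s D ρ) := by
  set A : Set M := {q | q ∈ D ∧ 0 ≤ impactNormSq g K q (ρ q)} with hA
  have hsub : photonDomain F K s D ρ ⊆ F.slice s := by
    rintro p (hp | hp)
    exacts [(hDs hp.1).1, hp.1]
  have hcl : photonDomain F K s D ρ ⊆ closure A := by
    rintro p (hp | hp)
    exacts [subset_closure hp, hp.2.2]
  -- `A` can acquire limit points in the slice in two ways: regular ones lie in `D` by relative
  -- closedness and keep the sign by continuity, while degenerate ones belong to `photonDomain` by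
  -- definition.
  have hAcl : ∀ p ∈ F.slice s, p ∈ closure A → p ∈ photonDomain F K s D ρ := by
    intro p hps hpA
    by_cases hp : p ∈ regularSet g K
    · have hpD : p ∈ D := hD p ⟨hps, hp⟩ (closure_mono (fun q hq ↦ hq.1) hpA)
      refine Or.inl ⟨hpD, ?_⟩
      have hcomp : ∀ a, ContinuousAt (fun q ↦ ρ q a) p := fun a ↦
        (continuous_apply a).continuousAt.comp (hρ p hpD)
      have hgram : ∀ a b, ContinuousAt (fun q ↦ gram g K q a b) p := fun a b ↦
        (hK.contMDiffAt_gram a b p).continuousAt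
      have hcont : ContinuousAt (fun q ↦ impactNormSq g K q (ρ q)) p := by
        simp only [impactNormSq_eq]
        exact ((((hcomp 0).mul (hcomp 0)).mul (hgram 0 0)).add
          (continuousAt_const.mul (((hcomp 0).mul (hcomp 1)).mul (hgram 0 1)))).add
          (((hcomp 1).mul (hcomp 1)).mul (hgram 1 1))
      by_contra hneg
      have h1 : ∀ᶠ q in 𝓝 p, impactNormSq g K q (ρ q) < 0 :=
        hcont.eventually (gt_mem_nhds (not_le.1 hneg))
      obtain ⟨q, hqA, hq⟩ := ((mem_closure_iff_frequently.1 hpA).and_eventually h1).exists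
      exact absurd hqA.2 (not_le.2 hq)
    · exact Or.inr ⟨hps, hp, hpA⟩
  obtain ⟨T, hT, hT', hTc⟩ := hcompact
  refine ⟨T, fun p hp ↦ hT p (hsub hp), fun p hp ↦ hT' p (hsub hp), fun c ↦ ?_⟩
  have : photonDomain F K s D ρ ∩ {p | T p = c} = (F.slice s ∩ {p | T p = c}) ∩ closure A := by
    ext p
    exact ⟨fun h ↦ ⟨⟨hsub h.1, h.2⟩, hcl h.1⟩, fun h ↦ ⟨hAcl p h.1.1 h.2, h.1.2⟩⟩
  rw [this]
  exact (hTc c).inter_right isClosed_closure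

/-! ### Constancy of the direction of the impact vector. -/

/-- Lowering the index of $\tau^a$ cancels the inverse Gram matrix: $\tau_a=\sqrt{-\mathcal
G}\,\epsilon_{ab}\rho^b$. The condition is therefore the vanishing of the cross product of $\rho$
with its derivative. -/
theorem directionConstAt_of_parallel (p : M) (ρ : M → Fin 2 → ℝ)
    (h : ∀ X : TangentSpace (𝓡 m) p, F.Tangent p X →
      ρ p 1 * dirDeriv (fun q ↦ ρ q 0) p X = ρ p 0 * dirDeriv (fun q ↦ ρ q 1) p X)
    (hp : p ∈ regularSet g K) : DirectionConstAt F K ρ p := by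
  intro X hX
  have hdet : IsUnit (gram g K p).det := isUnit_iff_ne_zero.2 (ne_of_lt hp)
  have hτ : tauLower g K p (ρ p) = √(-(gram g K p).det) • (!![0, 1; -1, 0] *ᵥ ρ p) := by
    rw [tauLower, Matrix.mulVec_smul, Matrix.mulVec_mulVec, Matrix.mul_nonsing_inv _ hdet,
      Matrix.one_mulVec]
  rw [hτ, Fin.sum_univ_two]
  simp only [Pi.smul_apply, smul_eq_mul, Matrix.mulVec, dotProduct, Fin.sum_univ_two,
    Matrix.of_apply, Matrix.cons_val', Matrix.cons_val_zero, Matrix.cons_val_one,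
    Matrix.cons_val_fin_one]
  linear_combination √(-(gram g K p).det) * h X hX

/-- A vector annihilated together with a non-zero vector by a non-zero quadratic form in two
variables to first order is parallel to it. -/
theorem parallel_of_quadratic {a b c x y u w : ℝ} (hxy : a * x + b * y ≠ 0 ∨ b * x + c * y ≠ 0)
    (h0 : (a * x + b * y) * x + (b * x + c * y) * y = 0)
    (h1 : (a * x + b * y) * u + (b * x + c * y) * w = 0) : y * u = x * w := by
  rcases hxy with h | h
  · exact mul_left_cancel₀ h (by linear_combination y * h1 - w * h0)
  · exact mul_left_cancel₀ h (by linear_combination u * h0 - x * h1)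

/-- A non-zero $2\times2$ matrix has a kernel of dimension at most one. This covers the double root
of the master equation, where the first-order condition is empty. -/
theorem parallel_of_kernel {a b c x y u w : ℝ} (h : a ≠ 0 ∨ b ≠ 0 ∨ c ≠ 0)
    (h0 : a * x + b * y = 0) (h1 : b * x + c * y = 0) (h2 : a * u + b * w = 0)
    (h3 : b * u + c * w = 0) : y * u = x * w := by
  rcases h with h | h | h
  · exact mul_left_cancel₀ h (by linear_combination y * h2 - w * h0)
  · exact mul_left_cancel₀ h (by linear_combination u * h0 - x * h2)
  · exact mul_left_cancel₀ h (by linear_combination u * h1 - x * h3)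

/-- A differentiable solution of a constant non-vacuous master equation has constant direction. -/
theorem directionConstAt_of_masterEq {p : M} (hp : p ∈ regularSet g K) {ρ : M → Fin 2 → ℝ}
    (hρ : MDifferentiableAt (𝓡 m) 𝓘(ℝ, Fin 2 → ℝ) ρ p) (hρ0 : ρ p ≠ 0)
    (hsymm : masterMatrix F K χ p 1 0 = masterMatrix F K χ p 0 1)
    (hM : masterMatrix F K χ p ≠ 0)
    (h : ∀ᶠ q in 𝓝[F.slice (F.Φ p)] p, MasterEq F K χ p (ρ q)) :
    DirectionConstAt F K ρ p := by
  have hd : ∀ a, MDifferentiableAt (𝓡 m) 𝓘(ℝ, ℝ) (fun q ↦ ρ q a) p := fun a ↦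
    (ContinuousLinearMap.proj (R := ℝ) (φ := fun _ : Fin 2 ↦ ℝ) a).mdifferentiableAt.comp p hρ
  refine directionConstAt_of_parallel p ρ (fun X hX ↦ ?_) hp
  set a := masterMatrix F K χ p 0 0 with ha
  set b := masterMatrix F K χ p 0 1 with hb
  set c := masterMatrix F K χ p 1 1 with hc
  have hquad : ∀ᶠ q in 𝓝[F.slice (F.Φ p)] p,
      (a * ρ q 0 + b * ρ q 1) * ρ q 0 + (b * ρ q 0 + c * ρ q 1) * ρ q 1 = 0 := by
    filter_upwards [h] with q hq
    rw [masterEq_iff, hsymm, ← ha, ← hb, ← hc] at hq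
    linear_combination hq
  have hmem : p ∈ F.slice (F.Φ p) := rfl
  have hquad0 := hquad.self_of_nhdsWithin hmem
  have hne : a ≠ 0 ∨ b ≠ 0 ∨ c ≠ 0 := by
    by_contra hcon
    push Not at hcon
    refine hM ?_
    ext i j
    fin_cases i <;> fin_cases j
    exacts [hcon.1, hcon.2.1, hsymm.trans hcon.2.1, hcon.2.2]
  have hlin : ∀ α β : ℝ, MDifferentiableAt (𝓡 m) 𝓘(ℝ, ℝ) (fun q ↦ α * ρ q 0 + β * ρ q 1) p ∧
      dirDeriv (fun q ↦ α * ρ q 0 + β * ρ q 1) p X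
        = α * dirDeriv (fun q ↦ ρ q 0) p X + β * dirDeriv (fun q ↦ ρ q 1) p X := by
    intro α β
    have hc : ∀ (γ : ℝ) i, MDifferentiableAt (𝓡 m) 𝓘(ℝ, ℝ) (fun q ↦ γ * ρ q i) p := fun γ i ↦
      mdifferentiableAt_const.mul (hd i)
    have hcd : ∀ (γ : ℝ) i, dirDeriv (fun q ↦ γ * ρ q i) p X
        = γ * dirDeriv (fun q ↦ ρ q i) p X := fun γ i ↦ by
      rw [dirDeriv_mul mdifferentiableAt_const (hd i), dirDeriv_const, mul_zero, add_zero]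
    exact ⟨(hc α 0).add (hc β 1), by rw [dirDeriv_add (hc α 0) (hc β 1), hcd, hcd]⟩
  -- The split is between a double and a simple root. If $\rho(p)$ lies in the kernel of $\mathcal
  -- M$, the differential of the quadratic form vanishes there and gives nothing; otherwise
  -- differentiating the equation once suffices.
  by_cases hker : a * ρ p 0 + b * ρ p 1 = 0 ∧ b * ρ p 0 + c * ρ p 1 = 0
  · have hdet : a * c = b ^ 2 := by
      obtain ⟨h1, h2⟩ := hker
      by_contra hne'
      refine hρ0 ?_
      have h3 : a * c - b ^ 2 ≠ 0 := sub_ne_zero.2 hne'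
      have hx : ρ p 0 = 0 := mul_left_cancel₀ h3 (by linear_combination c * h1 - b * h2)
      have hy : ρ p 1 = 0 := mul_left_cancel₀ h3 (by linear_combination a * h2 - b * h1)
      ext i
      fin_cases i
      exacts [hx, hy]
    -- With $ac=b^2$, multiplying the form by $a$ gives $(a\rho^1+b\rho^2)^2$ (components numbered
    -- from 1), so every nearby solution is in the kernel. These linear equations can then be
    -- differentiated.
    have e1 : ∀ᶠ q in 𝓝[F.slice (F.Φ p)] p, a * ρ q 0 + b * ρ q 1 = 0 := by
      filter_upwards [hquad] with q hq
      refine pow_eq_zero_iff two_ne_zero |>.1 ?_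
      linear_combination a * hq - ρ q 1 ^ 2 * hdet
    have e2 : ∀ᶠ q in 𝓝[F.slice (F.Φ p)] p, b * ρ q 0 + c * ρ q 1 = 0 := by
      filter_upwards [hquad] with q hq
      refine pow_eq_zero_iff two_ne_zero |>.1 ?_
      linear_combination c * hq - ρ q 0 ^ 2 * hdet
    have d1 := TimelikeFoliation.dirDeriv_eq_zero_of_eventually_const (hlin a b).1 e1 hX
    have d2 := TimelikeFoliation.dirDeriv_eq_zero_of_eventually_const (hlin b c).1 e2 hX
    rw [(hlin _ _).2] at d1 d2
    exact parallel_of_kernel hne hker.1 hker.2 d1 d2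
  · have m1 : MDifferentiableAt (𝓡 m) 𝓘(ℝ, ℝ) (fun q ↦ (a * ρ q 0 + b * ρ q 1) * ρ q 0) p :=
      (hlin a b).1.mul (hd 0)
    have m2 : MDifferentiableAt (𝓡 m) 𝓘(ℝ, ℝ) (fun q ↦ (b * ρ q 0 + c * ρ q 1) * ρ q 1) p :=
      (hlin b c).1.mul (hd 1)
    have d := TimelikeFoliation.dirDeriv_eq_zero_of_eventually_const (m1.add m2) hquad hX
    have d' : dirDeriv (fun q ↦ (a * ρ q 0 + b * ρ q 1) * ρ q 0
        + (b * ρ q 0 + c * ρ q 1) * ρ q 1) p X = 0 := d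
    rw [dirDeriv_add m1 m2, dirDeriv_mul (hlin a b).1 (hd 0), dirDeriv_mul (hlin b c).1 (hd 1),
      (hlin a b).2, (hlin b c).2] at d'
    exact parallel_of_quadratic (not_and_or.1 hker) hquad0 (by linear_combination d' / 2)

/-! ### Assembling the two photon surfaces. -/

/-- A regular limit point has the same solutions as the points of the solvable set near it. This is
the relative closedness needed for compact sections. -/
theorem mem_solvableSet_of_mem_closure (hK : IsTangentConformalPair g nabla F K)
    (hχ : SatisfiesLiftConditions nabla F K χ) {s : ℝ}
    (hχ0 : ∀ p ∈ F.slice s ∩ regularSet g K, χ p ≠ 0) {p : M}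
    (hp : p ∈ F.slice s ∩ regularSet g K) (hpc : p ∈ closure (solvableSet F K χ s)) :
    p ∈ solvableSet F K χ s := by
  have h := eventually_nhdsWithin_iff.1 (eventually_masterEq_iff hK hχ hχ0 hp)
  obtain ⟨q, ⟨hqs, -, v, hv, hqv⟩, hq⟩ :=
    ((mem_closure_iff_frequently.1 hpc).and_eventually h).exists
  exact ⟨hp.1, hp.2, v, hv, (hq hqs v).1 hqv⟩

theorem isFundamentalPhotonSurface_solvableSet (hnabla : IsLeviCivita g nabla)
    (hK : IsTangentConformalPair g nabla F K) (hχ : SatisfiesLiftConditions nabla F K χ) {s : ℝ}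
    (hcompact : F.HasCompactSpatialSections (F.slice s))
    (hχ0 : ∀ p ∈ F.slice s ∩ regularSet g K, χ p ≠ 0) {ρ : M → Fin 2 → ℝ}
    (hρ : IsImpactField nabla F K χ s ρ) :
    IsFundamentalPhotonSurface nabla F K χ s (photonDomain F K s (solvableSet F K χ s) ρ) ρ := by
  have hD : solvableSet F K χ s ⊆ F.slice s ∩ regularSet g K := fun p hp ↦ ⟨hp.1, hp.2.1⟩
  have hU : ∀ p ∈ photonDomain F K s (solvableSet F K χ s) ρ ∩ regularSet g K,
      p ∈ solvableSet F K χ s ∧ 0 ≤ impactNormSq g K p (ρ p) := by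
    rintro p ⟨hp | hp, hpr⟩
    exacts [hp, absurd hpr hp.2.1]
  refine ⟨?_, ?_, fun p hp ↦ hχ.umbilic p hp.2, fun p hp ↦ hχ0 p (hD (hU p hp).1),
    fun p hp ↦ hρ.diff p (hU p hp).1, fun p hp ↦ hρ.ne_zero p (hU p hp).1,
    fun p hp ↦ (hU p hp).2, fun p hp ↦ ?_, fun p hp ↦ hρ.master p (hU p hp).1⟩
  · rintro p (hp | hp)
    exacts [hp.1.1, hp.1]
  · exact hasCompactSpatialSections_photonDomain hK hcompact hD
      (fun p hp ↦ mem_solvableSet_of_mem_closure hK hχ hχ0 hp)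
      (fun p hp ↦ (hρ.diff p hp).continuousAt)
  · have hpD := (hU p hp).1
    by_cases hM : masterMatrix F K χ p = 0
    · exact hρ.at_umbilic p hpD (isUmbilicAt_of_masterMatrix_eq_zero hnabla hK hp.2
        (hχ0 p (hD hpD)) (hχ.umbilic p hp.2) hM)
    · refine directionConstAt_of_masterEq hp.2 (hρ.diff p hpD) (hρ.ne_zero p hpD)
        (hK.masterMatrix_comm hnabla χ 1 0 p) hM ?_
      rw [show F.Φ p = s from hpD.1]
      -- Nearby regular points of the slice inherit a solution from `p`, hence lie in the solvable
      -- set, where `ρ` is known to solve the equation. Its values there then solve the equation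
      -- frozen at `p`.
      filter_upwards [eventually_masterEq_iff hK hχ hχ0 (hD hpD), self_mem_nhdsWithin,
        mem_nhdsWithin_of_mem_nhds (hK.isOpen_regularSet.mem_nhds hp.2)] with q hq hqs hqr
      obtain ⟨v, hv, hpv⟩ := hpD.2.2
      exact (hq _).1 (hρ.master q ⟨hqs, hqr, v, hv, (hq v).2 hpv⟩)

/-- Being a solution is a locally constant property on the regular part of the slice, so it spreads
over a preconnected set. -/
theorem masterEq_of_mem_connectedComponentIn (hK : IsTangentConformalPair g nabla F K)
    (hχ : SatisfiesLiftConditions nabla F K χ) {s : ℝ}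
    (hχ0 : ∀ p ∈ F.slice s ∩ regularSet g K, χ p ≠ 0) {p₀ : M}
    (hp₀ : p₀ ∈ F.slice s ∩ regularSet g K) {v : Fin 2 → ℝ} (hv : MasterEq F K χ p₀ v) {p : M}
    (hp : p ∈ connectedComponentIn (F.slice s ∩ regularSet g K) p₀) : MasterEq F K χ p v := by
  have hsub := connectedComponentIn_subset (F.slice s ∩ regularSet g K) p₀
  have h := isPreconnected_connectedComponentIn.induction₂'
    (fun x y ↦ MasterEq F K χ x v → MasterEq F K χ y v) (fun x hx ↦ ?_)
    (fun x y z _ _ _ hxy hyz h ↦ hyz (hxy h)) (mem_connectedComponentIn hp₀) hp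
  · exact h hv
  · filter_upwards [nhdsWithin_mono x (hsub.trans Set.inter_subset_left)
      (eventually_masterEq_iff hK hχ hχ0 (hsub hx))] with y hy
    exact ⟨(hy v).2, (hy v).1⟩

/-- Adding a limit point keeps a set preconnected, so maximality absorbs it. This plays for part
(ii) the role that closedness of the solvable set plays for part (i). -/
theorem mem_connectedComponentIn_of_mem_closure {X : Type*} [TopologicalSpace X] {A : Set X}
    {x₀ x : X} (hx₀ : x₀ ∈ A) (hx : x ∈ A) (hxc : x ∈ closure (connectedComponentIn A x₀)) :
    x ∈ connectedComponentIn A x₀ := by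
  have h : IsPreconnected (insert x (connectedComponentIn A x₀)) :=
    isPreconnected_connectedComponentIn.subset_closure (Set.subset_insert _ _)
      (Set.insert_subset hxc subset_closure)
  exact h.subset_connectedComponentIn (Set.mem_insert_of_mem _ (mem_connectedComponentIn hx₀))
    (Set.insert_subset hx (connectedComponentIn_subset A x₀)) (Set.mem_insert _ _)

theorem isFundamentalPhotonSurface_connectedComponentIn
    (hK : IsTangentConformalPair g nabla F K) (hχ : SatisfiesLiftConditions nabla F K χ) {s : ℝ}
    (hcompact : F.HasCompactSpatialSections (F.slice s))
    (hχ0 : ∀ p ∈ F.slice s ∩ regularSet g K, χ p ≠ 0) {p₀ : M}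
    (hp₀ : p₀ ∈ F.slice s ∩ regularSet g K) {v : Fin 2 → ℝ} (hv0 : v ≠ 0)
    (hv : MasterEq F K χ p₀ v) :
    IsFundamentalPhotonSurface nabla F K χ s
      (photonDomain F K s (connectedComponentIn (F.slice s ∩ regularSet g K) p₀) (fun _ ↦ v))
      (fun _ ↦ v) := by
  set C := connectedComponentIn (F.slice s ∩ regularSet g K) p₀
  have hD : C ⊆ F.slice s ∩ regularSet g K := connectedComponentIn_subset _ _
  have hU : ∀ p ∈ photonDomain F K s C (fun _ ↦ v) ∩ regularSet g K,
      p ∈ C ∧ 0 ≤ impactNormSq g K p v := by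
    rintro p ⟨hp | hp, hpr⟩
    exacts [hp, absurd hpr hp.2.1]
  refine ⟨?_, ?_, fun p hp ↦ hχ.umbilic p hp.2, fun p hp ↦ hχ0 p (hD (hU p hp).1),
    fun p _ ↦ mdifferentiableAt_const, fun _ _ ↦ hv0,
    fun p hp ↦ (hU p hp).2, fun p hp X _ ↦ ?_,
    fun p hp ↦ masterEq_of_mem_connectedComponentIn hK hχ hχ0 hp₀ hv (hU p hp).1⟩
  · rintro p (hp | hp)
    exacts [(hD hp.1).1, hp.1]
  · exact hasCompactSpatialSections_photonDomain hK hcompact hD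
      (fun p hp ↦ mem_connectedComponentIn_of_mem_closure hp₀ hp)
      (fun p _ ↦ continuousAt_const)
  · simp [dirDeriv_const]

end PhotonSurface

theorem mainTheorem3 {m : ℕ} (hm : 4 ≤ m) {M : Type*} [TopologicalSpace M]
    [ChartedSpace (EuclideanSpace ℝ (Fin m)) M] [IsManifold (𝓡 m) ∞ M]
    [T2Space M] [SecondCountableTopology M]
    (g : LorentzianMetric m M)
    (nabla : CovariantDerivative (𝓡 m) (EuclideanSpace ℝ (Fin m))
      (fun p : M ↦ TangentSpace (𝓡 m) p))
    (hnabla : IsLeviCivita g nabla)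
    (F : TimelikeFoliation g)
    (K : Fin 2 → ∀ p : M, TangentSpace (𝓡 m) p)
    (hK : IsTangentConformalPair g nabla F K)
    (χ : M → ℝ) (hχ : SatisfiesLiftConditions nabla F K χ)
    (s : ℝ) (hcompact : F.HasCompactSpatialSections (F.slice s))
    (hχ0 : ∀ p ∈ F.slice s ∩ regularSet g K, χ p ≠ 0) :
    (∀ ρ : M → Fin 2 → ℝ, IsImpactField nabla F K χ s ρ →
      IsFundamentalPhotonSurface nabla F K χ s
        (photonDomain F K s (solvableSet F K χ s) ρ) ρ) ∧
    (∀ p₀ ∈ F.slice s ∩ regularSet g K, ∀ v : Fin 2 → ℝ, v ≠ 0 → MasterEq F K χ p₀ v →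
      (∀ p ∈ connectedComponentIn (F.slice s ∩ regularSet g K) p₀, MasterEq F K χ p v) ∧
      IsFundamentalPhotonSurface nabla F K χ s
        (photonDomain F K s (connectedComponentIn (F.slice s ∩ regularSet g K) p₀)
          (fun _ ↦ v)) (fun _ ↦ v)) := by
  refine ⟨fun ρ hρ ↦
    isFundamentalPhotonSurface_solvableSet hnabla hK hχ hcompact hχ0 hρ, fun p₀ hp₀ v hv0 hv ↦
    ⟨fun p hp ↦ masterEq_of_mem_connectedComponentIn hK hχ hχ0 hp₀ hv hp,
      isFundamentalPhotonSurface_connectedComponentIn hK hχ hcompact hχ0 hp₀ hv0 hv⟩⟩
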